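/- Let $0<a<b<\infty$, and let $F$ be the distribution function of a nonnegative random variable such that $1-F$ is slowly varying at infinity, i.e. $1-F(t)>0$ for all $t>0$ and $\frac{1-F(ct)}{1-F(t)}\to1$ as $t\to\infty$ for every $c>0$. Let $g$ be a Markov transition kernel on $[a,b]$ whose chain is Harris recurrent (there is a nonzero $\sigma$-finite measure $m$ on $[a,b]$ such that, from every starting point, the chain almost surely visits every Borel set $A$ with $m(A)>0$ infinitely often), and let $\rho_s$ be a stationary probability measure of $g$. Let $\lambda_0\in[a,b]$, let $\Lambda_0=\lambda_0,\Lambda_1,\Lambda_2,\dots$ be the homogeneous Markov chain with kernel $g$ started at $\lambda_0$, and let $X_0,X_1,\dots$ be waiting times which, conditionally on the whole sequence $(\Lambda_j)_{j\ge0}$, are independent, $X_j$ having distribution function $t\mapsto F(\Lambda_j t)$ (a scaled-type Markov renewal process). For $t>0$ let $N_{t,\lambda_0}=\inf\{n\ge0:\ \sum_{j=0}^{n-1}X_j\ge t\}$ be the number of renewals before time $t$, including the one at time $0$, and let $$\Phi_{t,\lambda_0}(A)=\mathbf P\bigl(\Lambda_{N_{t,\lambda_0}-1}\in A\bigr)$$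 be the distribution of the parameter of the current renewal at time $t$. Then for every Borel set $A\subseteq[a,b]$, $$\lim_{t\to\infty}\Phi_{t,\lambda_0}(A)=\rho_s(A).$$ -/

import Mathlib

open MeasureTheory ProbabilityTheory Filter Topology Set
open scoped ENNReal

/-- A positive function `L` on `(0, ∞)` is slowly varying at infinity if `L (c t) / L t → 1` as
`t → ∞`, for every `c > 0`. -/
def IsSlowlyVarying (L : ℝ → ℝ) : Prop :=
  (∀ t : ℝ, 0 < t → 0 < L t) ∧
    ∀ c : ℝ, 0 < c → Tendsto (fun t : ℝ => L (c * t) / L t) atTop (𝓝 1)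

/-- The law, on the space of sequences, of the homogeneous Markov chain with transition kernel `g`
started at `x` (given the first `n + 1` states, the next state has the law `g` at the last one of
these states). -/
noncomputable def chainLaw {I : Type*} [MeasurableSpace I] (g : Kernel I I) [IsMarkovKernel g]
    (x : I) : Measure (ℕ → I) :=
  Kernel.traj (X := fun _ : ℕ => I)
    (fun n : ℕ => g.comap (fun h : (∀ _ : Finset.Iic n, I) => h ⟨n, Finset.mem_Iic.2 le_rfl⟩)
      (measurable_pi_apply _)) 0 (fun _ => x)

instance chainLaw_isProbabilityMeasure {I : Type*} [MeasurableSpace I] (g : Kernel I I)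
    [IsMarkovKernel g] (x : I) : IsProbabilityMeasure (chainLaw g x) := by
  unfold chainLaw
  infer_instance

/-- A Markov chain is Harris recurrent if there is a nonzero `σ`-finite measure `m` such that
every measurable set `A` with `m A > 0` is almost surely visited infinitely often, from every
starting point. -/
def IsHarrisRecurrent {I : Type*} [MeasurableSpace I] (g : Kernel I I) [IsMarkovKernel g] : Prop :=
  ∃ m : Measure I, SigmaFinite m ∧ m ≠ 0 ∧
    ∀ A : Set I, MeasurableSet A → 0 < m A →
      ∀ x : I, ∀ᵐ w ∂(chainLaw g x), ∃ᶠ n in atTop, w n ∈ A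

/-- `X 0, X 1, …` are the waiting times of a scaled-type renewal process with parameters
`l 0, l 1, …`: they are independent, and `X j` has the distribution function `t ↦ F (l j * t)`,
where `F` is the distribution function of `ν`. -/
structure IsSTRP {Ω : Type*} [MeasurableSpace Ω] (ν : Measure ℝ) (l : ℕ → ℝ)
    (P : Measure Ω) (X : ℕ → Ω → ℝ) : Prop where
  measurable : ∀ j, Measurable (X j)
  distribution : ∀ j (t : ℝ), P {ω | X j ω ≤ t} = ENNReal.ofReal (cdf ν (l j * t))
  indep : iIndepFun X P

/-- The parameters `Lam 0, Lam 1, …` and the waiting times `X 0, X 1, …` form a scaled-type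
Markov renewal process with initial parameter `l₀`: the parameters are a homogeneous Markov chain
with transition kernel `g` started at `l₀`, and for every realization `l` of the parameters the
conditional law `κ l` of the waiting times makes them the waiting times of a scaled-type renewal
process with parameters `l`. -/
structure IsSTMRP {Ω : Type*} [MeasurableSpace Ω] {a b : ℝ} (ν : Measure ℝ)
    (g : Kernel (Icc a b) (Icc a b)) [IsMarkovKernel g] (l₀ : Icc a b)
    (P : Measure Ω) (Lam : ℕ → Ω → Icc a b) (X : ℕ → Ω → ℝ) : Prop where
  measurable_param : ∀ n, Measurable (Lam n)
  measurable_wait : ∀ n, Measurable (X n)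
  law : ∃ κ : Kernel (ℕ → Icc a b) (ℕ → ℝ), IsMarkovKernel κ ∧
    (∀ l : ℕ → Icc a b, IsSTRP ν (fun j => (l j : ℝ)) (κ l) (fun j x => x j)) ∧
    P.map (fun ω => ((fun n => Lam n ω), (fun n => X n ω))) = (chainLaw g l₀) ⊗ₘ κ

/-- The number of renewals before time `t`, including the one at time `0`: the renewal epochs are
`0, X 0, X 0 + X 1, …`, and their number in `[0, t)` is the least `n` with
`X 0 + ⋯ + X (n - 1) ≥ t`. -/
noncomputable def renewalCount {Ω : Type*} (X : ℕ → Ω → ℝ) (t : ℝ) (ω : Ω) : ℕ :=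
  sInf {n : ℕ | t ≤ ∑ j ∈ Finset.range n, X j ω}

/-- The probability that the parameter of the current renewal at time `t` lies in `A`. -/
noncomputable def currentParamProb {Ω I : Type*} [MeasurableSpace Ω] (P : Measure Ω)
    (Lam : ℕ → Ω → I) (X : ℕ → Ω → ℝ) (t : ℝ) (A : Set I) : ℝ≥0∞ :=
  P {ω | Lam (renewalCount X t ω - 1) ω ∈ A}

/-! A slowly varying tail makes the renewal in progress at a large time `t` a single big jump: with
probability tending to one, the first `n` waiting times sum to less than `t` and the next one alone
exceeds `t`, for some `n`. The proof bounds the probability of this event from below, jointly with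
`Λ_n ∈ A`.

Write `L = 1 - F`. For every realization of the parameters in `[a, b]`, the event at index `n` has
probability at least `L(bt)` times `F(at)^n` minus an error (`IsSTRP.le_measureReal_bigJumpEvent`).
The error bounds the chance that waiting times all at most `t` still sum to `t`; it comes from
Markov's inequality and the truncated mean. Summed over `n`, the errors contribute a multiple of
`E[Y; Y ≤ bt] / (bt L(bt))`, which vanishes by `tendsto_truncMean_div`. With `e = L(at)`, the main
term is `L(bt)/L(at)` times the Abel mean `e ∑ (1-e)^n P(Λ_n ∈ A)`. The ratio tends to 1 and `e` to
0.

Abel means converge when Cesàro means do, so only an averaged ergodic theorem is needed and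
periodicity is harmless. It follows from the mean ergodic theorem in `L²(ρ)`: Harris recurrence
makes invariant functions constant, and also carries the convergence from almost every starting
point to every one (`tendsto_kernelAverage`).

The lower bounds for `A` and for `Aᶜ` together give the limit. -/

/-! ### One-dimensional and pair marginals of the chain. -/

section ChainLaw

variable {I : Type*} [MeasurableSpace I] (g : Kernel I I)

/-- The action of a kernel on functions. -/
noncomputable def kernelOp (g : Kernel I I) (f : I → ℝ) (x : I) : ℝ := ∫ y, f y ∂g x

theorem measurable_kernelOp {f : I → ℝ} (hf : Measurable f) : Measurable (kernelOp g f) :=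
  (hf.stronglyMeasurable.integral_kernel (κ := g)).measurable

theorem measurable_kernelOp_iterate {f : I → ℝ} (hf : Measurable f) (k : ℕ) :
    Measurable ((kernelOp g)^[k] f) := by
  induction k with
  | zero => exact hf
  | succ k ih => rw [Function.iterate_succ_apply']; exact measurable_kernelOp g ih

variable [IsMarkovKernel g]

theorem chainLaw_map_zero (x : I) : (chainLaw g x).map (fun w => w 0) = Measure.dirac x := by
  have h : (fun w : ℕ → I => w 0) =
      (fun h : (∀ _ : Finset.Iic 0, I) => h ⟨0, Finset.mem_Iic.2 le_rfl⟩) ∘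
        Preorder.frestrictLe 0 := rfl
  rw [h, ← Measure.map_map (by fun_prop) (by fun_prop), chainLaw, Kernel.traj_map_frestrictLe_apply,
    Kernel.partialTraj_self, Kernel.id_apply]
  exact Measure.map_dirac' (f := fun h : (∀ _ : Finset.Iic 0, I) => h ⟨0, Finset.mem_Iic.2 le_rfl⟩)
    (measurable_pi_apply _) (fun _ => x)

/-- Used with `f` the projection of a history to its last state: the step kernel of `chainLaw`
depends on the history only through that state. -/
theorem map_compProd_comap {α β γ : Type*} [MeasurableSpace α] [MeasurableSpace β]
    [MeasurableSpace γ] (μ : Measure α) [SFinite μ] (κ : Kernel β γ) [IsSFiniteKernel κ]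
    {f : α → β} (hf : Measurable f) :
    (μ ⊗ₘ κ.comap f hf).map (Prod.map f id) = μ.map f ⊗ₘ κ := by
  ext s hs
  rw [Measure.map_apply (by fun_prop) hs, Measure.compProd_apply (hs.preimage (by fun_prop)),
    Measure.compProd_apply hs, lintegral_map (Kernel.measurable_kernel_prodMk_left hs) hf]
  rfl

theorem chainLaw_map_pair (x : I) (n : ℕ) :
    (chainLaw g x).map (fun w => (w n, w (n + 1))) =
      (chainLaw g x).map (fun w => w n) ⊗ₘ g := by
  have h : (fun w : ℕ → I => (w n, w (n + 1))) =
      Prod.map (fun h : (∀ _ : Finset.Iic n, I) => h ⟨n, Finset.mem_Iic.2 le_rfl⟩) id ∘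
        (fun w => (Preorder.frestrictLe n w, w (n + 1))) := rfl
  have h' : (fun w : ℕ → I => w n) =
      (fun h : (∀ _ : Finset.Iic n, I) => h ⟨n, Finset.mem_Iic.2 le_rfl⟩) ∘
        Preorder.frestrictLe n := rfl
  rw [h, ← Measure.map_map (by fun_prop) (by fun_prop), chainLaw,
    ← Kernel.partialTraj_compProd_eq_map_traj (Nat.zero_le n), map_compProd_comap, h',
    ← Measure.map_map (by fun_prop) (by fun_prop), Kernel.traj_map_frestrictLe_apply]

theorem chainLaw_map_succ (x : I) (n : ℕ) :
    (chainLaw g x).map (fun w => w (n + 1)) = g ∘ₘ (chainLaw g x).map (fun w => w n) := by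
  have h : (fun w : ℕ → I => w (n + 1)) = Prod.snd ∘ (fun w => (w n, w (n + 1))) := rfl
  rw [h, ← Measure.map_map (by fun_prop) (by fun_prop), chainLaw_map_pair]
  exact Measure.snd_compProd _ _

theorem abs_kernelOp_le {f : I → ℝ} {C : ℝ} (hC : ∀ x, |f x| ≤ C) (x : I) :
    |kernelOp g f x| ≤ C := by
  have := norm_integral_le_of_norm_le_const (μ := g x) (f := f) (C := C) (ae_of_all _ hC)
  simpa [kernelOp] using this

theorem abs_kernelOp_iterate_le {f : I → ℝ} {C : ℝ} (hC : ∀ x, |f x| ≤ C) (k : ℕ) (x : I) :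
    |(kernelOp g)^[k] f x| ≤ C := by
  induction k generalizing x with
  | zero => exact hC x
  | succ k ih => rw [Function.iterate_succ_apply']; exact abs_kernelOp_le g ih x

theorem integrable_of_abs_le {α : Type*} [MeasurableSpace α] (μ : Measure α) [IsFiniteMeasure μ]
    {f : α → ℝ} (hf : Measurable f) {C : ℝ} (hC : ∀ x, |f x| ≤ C) : Integrable f μ :=
  Integrable.of_bound hf.aestronglyMeasurable C (ae_of_all _ hC)

theorem integral_comp_measure (μ : Measure I) [IsFiniteMeasure μ] {f : I → ℝ} (hf : Measurable f)
    {C : ℝ} (hC : ∀ x, |f x| ≤ C) : ∫ y, f y ∂(g ∘ₘ μ) = ∫ x, kernelOp g f x ∂μ := by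
  have h : g ∘ₘ μ = (μ ⊗ₘ g).map Prod.snd := (Measure.snd_compProd μ g).symm
  rw [h, integral_map (by fun_prop) hf.aestronglyMeasurable,
    Measure.integral_compProd (f := fun p : I × I => f p.2)
      (integrable_of_abs_le _ (hf.comp measurable_snd) fun p => hC p.2)]
  rfl

theorem integral_chainLaw_succ {f : I → ℝ} (hf : Measurable f) {C : ℝ} (hC : ∀ x, |f x| ≤ C)
    (x : I) (n : ℕ) :
    ∫ w, f (w (n + 1)) ∂chainLaw g x = ∫ w, kernelOp g f (w n) ∂chainLaw g x := by
  have h1 : IsProbabilityMeasure ((chainLaw g x).map (fun w => w n)) :=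
    Measure.isProbabilityMeasure_map (measurable_pi_apply n).aemeasurable
  rw [← integral_map (φ := fun w : ℕ → I => w (n + 1)) (measurable_pi_apply _).aemeasurable
      hf.aestronglyMeasurable, chainLaw_map_succ, integral_comp_measure g _ hf hC,
    integral_map (φ := fun w : ℕ → I => w n) (measurable_pi_apply _).aemeasurable
      (measurable_kernelOp g hf).aestronglyMeasurable]

theorem integral_chainLaw_iterate {f : I → ℝ} (hf : Measurable f) {C : ℝ} (hC : ∀ x, |f x| ≤ C)
    (x : I) (n k : ℕ) :
    ∫ w, (kernelOp g)^[k] f (w n) ∂chainLaw g x = (kernelOp g)^[k + n] f x := by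
  -- Each time step moves one application of the kernel from the law to the function, so `k` must
  -- vary.
  induction n generalizing k with
  | zero =>
    rw [← integral_map (φ := fun w : ℕ → I => w 0) (measurable_pi_apply _).aemeasurable
      (measurable_kernelOp_iterate g hf k).aestronglyMeasurable, chainLaw_map_zero,
      integral_dirac' _ _ (measurable_kernelOp_iterate g hf k).stronglyMeasurable]
    rfl
  | succ n ih =>
    rw [integral_chainLaw_succ g (measurable_kernelOp_iterate g hf k)
      (abs_kernelOp_iterate_le g hC k), ← Function.iterate_succ_apply' (kernelOp g) k, ih,
      Nat.succ_add_eq_add_succ]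

end ChainLaw

/-! ### Absorbing sets and the triviality of almost invariant sets. -/

section Absorbing

variable {I : Type*} [MeasurableSpace I] {g : Kernel I I}

variable {ρ : Measure I}

theorem lintegral_kernel_apply_of_invariant (hρ : Kernel.Invariant g ρ) {N : Set I}
    (hN : MeasurableSet N) : ∫⁻ x, g x N ∂ρ = ρ N := by
  rw [← Measure.bind_apply hN g.measurable.aemeasurable, hρ.def]

/-- Every null set of an invariant measure is contained in a null set with absorbing complement. -/
theorem exists_null_absorbing_compl (hρ : Kernel.Invariant g ρ) {N₀ : Set I}
    (h0 : ρ N₀ = 0) :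
    ∃ N, N₀ ⊆ N ∧ MeasurableSet N ∧ ρ N = 0 ∧ ∀ x ∉ N, g x N = 0 := by
  -- Adding the points that reach `M` in one step with positive probability keeps a null set null,
  -- since `∫ g x M ∂ρ = ρ M`. The union of the iterates is closed under this operation.
  let S : Set I → Set I := fun M => M ∪ {x | g x M ≠ 0}
  let B : ℕ → Set I := fun n => S^[n] (toMeasurable ρ N₀)
  have hBs : ∀ n, B (n + 1) = S (B n) := fun n => Function.iterate_succ_apply' _ _ _
  have hB : ∀ n, MeasurableSet (B n) ∧ ρ (B n) = 0 := by
    intro n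
    induction n with
    | zero => exact ⟨measurableSet_toMeasurable _ _, by simpa [B] using h0⟩
    | succ n ih =>
      rw [hBs]
      refine ⟨ih.1.union ((g.measurable_coe ih.1) (measurableSet_singleton 0).compl), ?_⟩
      refine measure_union_null ih.2 ?_
      have := lintegral_kernel_apply_of_invariant hρ ih.1
      rw [ih.2, lintegral_eq_zero_iff (g.measurable_coe ih.1)] at this
      exact ae_iff.1 this
  refine ⟨⋃ n, B n, (subset_toMeasurable _ _).trans (subset_iUnion B 0),
    MeasurableSet.iUnion fun n => (hB n).1, measure_iUnion_null fun n => (hB n).2, ?_⟩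
  intro x hx
  refine measure_iUnion_null fun n => ?_
  by_contra h
  refine hx (mem_iUnion.2 ⟨n + 1, ?_⟩)
  rw [hBs]
  exact Or.inr h

variable [IsMarkovKernel g]

/-- Almost surely, the chain does not leave an absorbing set. -/
theorem ae_chainLaw_notMem_succ {N : Set I} (hN : MeasurableSet N)
    (hNg : ∀ x ∉ N, g x N = 0) (x : I) :
    ∀ᵐ w ∂chainLaw g x, ∀ n, w n ∉ N → w (n + 1) ∉ N := by
  rw [ae_all_iff]
  intro n
  have h : ∀ᵐ p ∂(chainLaw g x).map (fun w => (w n, w (n + 1))), p.1 ∉ N → p.2 ∉ N := by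
    rw [chainLaw_map_pair]
    have hs : MeasurableSet {p : I × I | p.1 ∉ N → p.2 ∉ N} := by
      have : {p : I × I | p.1 ∉ N → p.2 ∉ N} = Prod.fst ⁻¹' N ∪ Prod.snd ⁻¹' Nᶜ := by
        ext p; simp [or_iff_not_imp_left]
      rw [this]
      exact (hN.preimage measurable_fst).union (hN.compl.preimage measurable_snd)
    rw [Measure.ae_compProd_iff hs]
    refine ae_of_all _ fun y => ?_
    by_cases hy : y ∈ N
    · simp [hy]
    · have := hNg y hy
      simpa [hy, ae_iff] using this
  exact ae_of_ae_map (by fun_prop) h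

theorem ae_chainLaw_forall_notMem {N : Set I} (hN : MeasurableSet N)
    (hNg : ∀ x ∉ N, g x N = 0) {x : I} (hx : x ∉ N) :
    ∀ᵐ w ∂chainLaw g x, ∀ n, w n ∉ N := by
  have h0 : ∀ᵐ w ∂chainLaw g x, w 0 ∉ N := by
    have : ∀ᵐ y ∂(chainLaw g x).map (fun w => w 0), y ∉ N := by
      rw [chainLaw_map_zero]
      exact (ae_dirac_iff hN.compl).2 hx
    exact ae_of_ae_map (measurable_pi_apply 0).aemeasurable this
  filter_upwards [h0, ae_chainLaw_notMem_succ hN hNg x] with w h0 h n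
  induction n with
  | zero => exact h0
  | succ n ih => exact h n ih

/-- If `Nᶜ` is absorbing and almost surely hit, then the chain is eventually in `Nᶜ`. -/
theorem tendsto_chainLaw_mem {N : Set I} (hN : MeasurableSet N)
    (hNg : ∀ x ∉ N, g x N = 0) {x : I} (hhit : ∀ᵐ w ∂chainLaw g x, ∃ n, w n ∉ N) :
    Tendsto (fun n => (chainLaw g x).real {w | w n ∈ N}) atTop (𝓝 0) := by
  have hlim : ∀ᵐ w ∂chainLaw g x,
      Tendsto (fun n => N.indicator (fun _ => (1 : ℝ)) (w n)) atTop (𝓝 0) := by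
    filter_upwards [hhit, ae_chainLaw_notMem_succ hN hNg x] with w ⟨n, hn⟩ h
    refine tendsto_const_nhds.congr' ?_
    filter_upwards [eventually_ge_atTop n] with k hk
    have : w k ∉ N := by
      induction k, hk using Nat.le_induction with
      | base => exact hn
      | succ k _ ih => exact h k ih
    simp [this]
  have := tendsto_integral_of_dominated_convergence (μ := chainLaw g x) (fun _ => (1 : ℝ))
    (F := fun n w => N.indicator (fun _ => (1 : ℝ)) (w n)) (f := fun _ => 0)
    (fun n => ((measurable_const.indicator hN).comp (measurable_pi_apply n)).aestronglyMeasurable)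
    (integrable_const _)
    (fun n => ae_of_all _ fun w => by
      by_cases h : w n ∈ N <;> simp [h]) hlim
  simp only [integral_zero] at this
  refine this.congr fun n => ?_
  have h2 : (fun w : ℕ → I => N.indicator (fun _ => (1 : ℝ)) (w n)) =
      ((fun w : ℕ → I => w n) ⁻¹' N).indicator (fun _ => (1 : ℝ)) := by
    ext w; rfl
  rw [h2, integral_indicator_const _ (hN.preimage (measurable_pi_apply n))]
  simp [Set.preimage]

/-- Almost invariant sets of a Harris recurrent chain are trivial. -/
theorem ae_mem_or_ae_notMem_of_invariant (hg : IsHarrisRecurrent g) (hρ : Kernel.Invariant g ρ)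
    {B : Set I} (hB : MeasurableSet B) (h1 : ∀ᵐ x ∂ρ, x ∈ B → g x Bᶜ = 0)
    (h2 : ∀ᵐ x ∂ρ, x ∉ B → g x B = 0) : (∀ᵐ x ∂ρ, x ∈ B) ∨ ∀ᵐ x ∂ρ, x ∉ B := by
  obtain ⟨m, -, hm0, hm⟩ := hg
  obtain ⟨N, hAN, hN, hN0, hNg⟩ := exists_null_absorbing_compl hρ (ae_iff.1 (h1.and h2))
  -- `D \ N` is absorbing and nonempty, and a chain started there never visits `Dᶜ ∪ N`; Harris
  -- recurrence then forces `m Dᶜ = 0`. Using this for both `B` and `Bᶜ` would give `m = 0`.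
  have key : ∀ D : Set I, MeasurableSet D → (∀ x ∉ N, x ∈ D → g x Dᶜ = 0) → ρ D ≠ 0 →
      m Dᶜ = 0 := by
    intro D hD hDg hρD
    have hne : (D \ N).Nonempty := by
      by_contra h
      rw [not_nonempty_iff_eq_empty, sdiff_eq_empty] at h
      exact hρD (measure_mono_null h hN0)
    obtain ⟨x, hxD, hxN⟩ := hne
    have hM : MeasurableSet (Dᶜ ∪ N) := hD.compl.union hN
    have hMg : ∀ y ∉ Dᶜ ∪ N, g y (Dᶜ ∪ N) = 0 := by
      intro y hy
      simp only [mem_union, mem_compl_iff, not_or, not_not] at hy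
      exact measure_union_null (hDg y hy.2 hy.1) (hNg y hy.2)
    refine measure_mono_null (subset_union_left (t := N)) ?_
    by_contra h
    have := (hm _ hM (pos_iff_ne_zero.2 h) x).and
      (ae_chainLaw_forall_notMem hM hMg (x := x) (by simp [hxD, hxN]))
    obtain ⟨w, hw, hw'⟩ := this.exists
    obtain ⟨n, hn⟩ := hw.exists
    exact hw' n hn
  have hN' : ∀ x ∉ N, (x ∈ B → g x Bᶜ = 0) ∧ (x ∉ B → g x B = 0) := by
    intro x hx
    by_contra h
    exact hx (hAN h)
  by_contra! hcon
  obtain ⟨hc1, hc2⟩ := hcon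
  have hBc : ρ Bᶜ ≠ 0 := fun h =>
    hc1 ((measure_eq_zero_iff_ae_notMem.1 h).mono fun _ hx => not_not.2 (notMem_compl_iff.1 hx))
  have hB' : ρ B ≠ 0 := fun h => hc2 (measure_eq_zero_iff_ae_notMem.1 h)
  have e1 := key B hB (fun x hx hxB => (hN' x hx).1 hxB) hB'
  have e2 := key Bᶜ hB.compl (fun x hx hxB => by rw [compl_compl]; exact (hN' x hx).2 hxB) hBc
  refine hm0 (Measure.measure_univ_eq_zero.1 ?_)
  rw [← union_compl_self Bᶜ]
  exact measure_union_null e1 e2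

variable [IsProbabilityMeasure ρ]

/-- A `ρ`-null set lies in a null set `N` that the chain never enters from outside; were `m N`
positive, `N` would be visited from everywhere. -/
theorem absolutelyContinuous_of_recurrent (hρ : Kernel.Invariant g ρ) {m : Measure I}
    (hm : ∀ A : Set I, MeasurableSet A → 0 < m A →
      ∀ x : I, ∀ᵐ w ∂chainLaw g x, ∃ᶠ n in atTop, w n ∈ A) : m ≪ ρ := by
  intro A hA
  obtain ⟨N, hAN, hN, hN0, hNg⟩ := exists_null_absorbing_compl hρ hA
  refine measure_mono_null hAN ?_
  by_contra h
  have hne : N ≠ univ := by rintro rfl; simp at hN0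
  obtain ⟨x, hx⟩ := (ne_univ_iff_exists_notMem N).1 hne
  have := (hm N hN (pos_iff_ne_zero.2 h) x).and (ae_chainLaw_forall_notMem hN hNg hx)
  obtain ⟨w, hw, hw'⟩ := this.exists
  obtain ⟨n, hn⟩ := hw.exists
  exact hw' n hn

/-- Since `m N = 0`, the complement has positive `m`-measure, so it is hit almost surely, and it is
never left again. -/
theorem tendsto_chainLaw_null (hg : IsHarrisRecurrent g) (hρ : Kernel.Invariant g ρ)
    {N : Set I} (hN : MeasurableSet N) (hN0 : ρ N = 0) (hNg : ∀ x ∉ N, g x N = 0) (x : I) :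
    Tendsto (fun n => (chainLaw g x).real {w | w n ∈ N}) atTop (𝓝 0) := by
  obtain ⟨m, -, hm0, hm⟩ := hg
  have hmN : m N = 0 := absolutelyContinuous_of_recurrent hρ hm hN0
  have hmc : 0 < m Nᶜ := by
    rw [pos_iff_ne_zero]
    intro h
    refine hm0 (Measure.measure_univ_eq_zero.1 ?_)
    rw [← union_compl_self N]
    exact measure_union_null hmN h
  refine tendsto_chainLaw_mem hN hNg ?_
  filter_upwards [hm _ hN.compl hmc x] with w hw using hw.exists

end Absorbing

/-! ### Cesàro averages of the iterated kernel. -/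

section Cesaro

variable {I : Type*} [MeasurableSpace I] (g : Kernel I I)

/-- The averages of the first `n` iterates of a kernel applied to a function. -/
noncomputable def kernelAverage (f : I → ℝ) (n : ℕ) (x : I) : ℝ :=
  (n : ℝ)⁻¹ * ∑ k ∈ Finset.range n, (kernelOp g)^[k] f x

theorem measurable_kernelAverage {f : I → ℝ} (hf : Measurable f) (n : ℕ) :
    Measurable (kernelAverage g f n) :=
  (Finset.measurable_sum _ fun k _ => measurable_kernelOp_iterate g hf k).const_mul _

variable [IsMarkovKernel g]

theorem abs_kernelAverage_le {f : I → ℝ} {C : ℝ} (hC : ∀ x, |f x| ≤ C) (n : ℕ) (x : I) :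
    |kernelAverage g f n x| ≤ C := by
  have hC0 : 0 ≤ C := (abs_nonneg _).trans (hC x)
  rw [kernelAverage, abs_mul, abs_of_nonneg (by positivity)]
  have h : |∑ k ∈ Finset.range n, (kernelOp g)^[k] f x| ≤ n * C := by
    refine (Finset.abs_sum_le_sum_abs _ _).trans ?_
    refine (Finset.sum_le_sum fun k _ => abs_kernelOp_iterate_le g hC k x).trans ?_
    simp
  rcases Nat.eq_zero_or_pos n with rfl | hn
  · simpa using hC0
  · have : (0 : ℝ) < n := by exact_mod_cast hn
    calc (n : ℝ)⁻¹ * |∑ k ∈ Finset.range n, (kernelOp g)^[k] f x| ≤ (n : ℝ)⁻¹ * (n * C) := by gcongr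
      _ = C := by field_simp

/-- Running the chain `k` steps first shifts the averaging window by `k`; each unit shift exchanges
one term for another, at cost at most `2 * C`. -/
theorem abs_kernelAverage_sub_integral_le {f : I → ℝ} (hf : Measurable f) {C : ℝ}
    (hC : ∀ x, |f x| ≤ C) (x : I) (n k : ℕ) :
    |(∫ w, kernelAverage g f n (w k) ∂chainLaw g x) - kernelAverage g f n x| ≤
      (n : ℝ)⁻¹ * (2 * k * C) := by
  set p : ℕ → ℝ := fun j => (kernelOp g)^[j] f x with hp
  have hpC : ∀ j, |p j| ≤ C := fun j => abs_kernelOp_iterate_le g hC j x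
  have h1 : ∫ w, kernelAverage g f n (w k) ∂chainLaw g x =
      (n : ℝ)⁻¹ * ∑ j ∈ Finset.range n, p (j + k) := by
    simp only [kernelAverage]
    rw [integral_const_mul, integral_finsetSum]
    · simp_rw [integral_chainLaw_iterate g hf hC]
      rfl
    · intro j _
      exact integrable_of_abs_le _ ((measurable_kernelOp_iterate g hf j).comp
        (measurable_pi_apply k)) fun w => abs_kernelOp_iterate_le g hC j _
  have h2 : ∀ k : ℕ, |∑ j ∈ Finset.range n, p (j + k) - ∑ j ∈ Finset.range n, p j| ≤
      2 * k * C := by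
    intro k
    induction k with
    | zero => simp
    | succ k ih =>
      have h3 : ∑ j ∈ Finset.range n, p (j + (k + 1)) - ∑ j ∈ Finset.range n, p (j + k) =
          p (n + k) - p k := by
        rw [← Finset.sum_sub_distrib]
        have := Finset.sum_range_sub (fun j => p (j + k)) n
        simp only [zero_add] at this
        rw [← this]
        refine Finset.sum_congr rfl fun j _ => ?_
        rw [add_assoc, add_comm 1 k]
      have e1 := abs_le.1 ih
      have e2 := abs_le.1 (hpC (n + k))
      have e3 := abs_le.1 (hpC k)
      rw [abs_le]
      push_cast
      constructor <;> nlinarith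
  have h4 : kernelAverage g f n x = (n : ℝ)⁻¹ * ∑ j ∈ Finset.range n, p j := rfl
  rw [h1, h4, ← mul_sub, abs_mul, abs_of_nonneg (by positivity : (0 : ℝ) ≤ (n : ℝ)⁻¹)]
  gcongr
  exact h2 k

end Cesaro

/-! ### The mean ergodic theorem, and its extension to every starting point. -/

section MeanErgodic

variable {I : Type*} [MeasurableSpace I] {g : Kernel I I} [IsMarkovKernel g]
  {ρ : Measure I} [IsProbabilityMeasure ρ]

theorem measurePreserving_fst_compProd (g : Kernel I I) [IsMarkovKernel g] (ρ : Measure I)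
    [IsProbabilityMeasure ρ] : MeasurePreserving Prod.fst (ρ ⊗ₘ g) ρ :=
  ⟨measurable_fst, Measure.fst_compProd ρ g⟩

theorem measurePreserving_snd_compProd (hρ : Kernel.Invariant g ρ) :
    MeasurePreserving Prod.snd (ρ ⊗ₘ g) ρ :=
  ⟨measurable_snd, (Measure.snd_compProd ρ g).trans hρ.def⟩

/-- The action of a Markov kernel on the square integrable functions of an invariant measure. -/
noncomputable def kernelL2 (hρ : Kernel.Invariant g ρ) : Lp ℝ 2 ρ →L[ℝ] Lp ℝ 2 ρ :=
  (ContinuousLinearMap.adjoint (Lp.compMeasurePreservingₗᵢ (E := ℝ) (p := 2) ℝ Prod.fst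
    (measurePreserving_fst_compProd g ρ)).toContinuousLinearMap) ∘L
  (Lp.compMeasurePreservingₗᵢ (E := ℝ) (p := 2) ℝ Prod.snd
    (measurePreserving_snd_compProd hρ)).toContinuousLinearMap

/-- For a stationary pair `(Y₀, Y₁)` with law `ρ ⊗ₘ g`, the operator is the conditional expectation
of `F(Y₁)` given `Y₀`. Both pullbacks are isometries, which gives the contraction bound and the
rigidity of fixed vectors. -/
theorem inner_kernelL2 (hρ : Kernel.Invariant g ρ) (v F : Lp ℝ 2 ρ) :
    inner ℝ v (kernelL2 hρ F) =
      inner ℝ (Lp.compMeasurePreserving Prod.fst (measurePreserving_fst_compProd g ρ) v)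
        (Lp.compMeasurePreserving Prod.snd (measurePreserving_snd_compProd hρ) F) := by
  rw [kernelL2, ContinuousLinearMap.comp_apply, ContinuousLinearMap.adjoint_inner_right]
  rfl

theorem norm_kernelL2_le (hρ : Kernel.Invariant g ρ) : ‖kernelL2 hρ‖ ≤ 1 := by
  refine ContinuousLinearMap.opNorm_le_bound _ zero_le_one fun F => ?_
  have h := inner_kernelL2 hρ (kernelL2 hρ F) F
  have h2 := real_inner_le_norm
    (Lp.compMeasurePreserving Prod.fst (measurePreserving_fst_compProd g ρ) (kernelL2 hρ F))
    (Lp.compMeasurePreserving Prod.snd (measurePreserving_snd_compProd hρ) F)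
  rw [← h, real_inner_self_eq_norm_sq, Lp.norm_compMeasurePreserving,
    Lp.norm_compMeasurePreserving] at h2
  rw [one_mul]
  by_contra! hlt
  nlinarith [norm_nonneg F]

theorem kernelL2_toLp (hρ : Kernel.Invariant g ρ) {f : I → ℝ} (hf : Measurable f) {C : ℝ}
    (hC : ∀ x, |f x| ≤ C) (h1 : MemLp f 2 ρ) (h2 : MemLp (kernelOp g f) 2 ρ) :
    kernelL2 hρ (h1.toLp f) = h2.toLp (kernelOp g f) := by
  refine ext_inner_left ℝ fun v => ?_
  rw [inner_kernelL2, L2.inner_def, L2.inner_def]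
  have hv : Integrable v ρ := (Lp.memLp v).integrable (by norm_num)
  have e1 : ∫ p, inner ℝ
      (Lp.compMeasurePreserving Prod.fst (measurePreserving_fst_compProd g ρ) v p)
      (Lp.compMeasurePreserving Prod.snd (measurePreserving_snd_compProd hρ) (h1.toLp f) p)
        ∂(ρ ⊗ₘ g) = ∫ p, v p.1 * f p.2 ∂(ρ ⊗ₘ g) := by
    refine integral_congr_ae ?_
    filter_upwards [Lp.coeFn_compMeasurePreserving v (measurePreserving_fst_compProd g ρ),
      Lp.coeFn_compMeasurePreserving (h1.toLp f) (measurePreserving_snd_compProd hρ),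
      (measurePreserving_snd_compProd hρ).quasiMeasurePreserving.ae h1.coeFn_toLp] with p a1 a2 a3
    rw [a1, a2]
    simp only [Function.comp_apply, a3]
    exact mul_comm _ _
  have hint : Integrable (fun p : I × I => v p.1 * f p.2) (ρ ⊗ₘ g) := by
    have hv' : Integrable (fun p : I × I => v p.1) (ρ ⊗ₘ g) :=
      (measurePreserving_fst_compProd g ρ).integrable_comp_of_integrable hv
    exact hv'.mul_bdd (c := C) (hf.comp measurable_snd).aestronglyMeasurable
      (ae_of_all _ fun p => hC p.2)
  rw [e1, Measure.integral_compProd hint]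
  refine integral_congr_ae ?_
  filter_upwards [h2.coeFn_toLp] with x hx
  rw [hx, integral_const_mul]
  exact mul_comm _ _

/-- For a Harris recurrent chain the invariant functions are constant. -/
theorem ae_eq_const_of_kernelL2_eq_self (hg : IsHarrisRecurrent g) (hρ : Kernel.Invariant g ρ)
    {F : Lp ℝ 2 ρ} (hF : kernelL2 hρ F = F) : ∃ c : ℝ, F =ᵐ[ρ] Function.const I c := by
  -- `‖F(Y₁) - F(Y₀)‖² = 2‖F‖² - 2⟪F, TF⟫`, with `T` the kernel operator, vanishes when `TF = F`.
  have h0 : Lp.compMeasurePreserving Prod.snd (measurePreserving_snd_compProd hρ) F =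
      Lp.compMeasurePreserving Prod.fst (measurePreserving_fst_compProd g ρ) F := by
    rw [← sub_eq_zero, ← norm_eq_zero, ← sq_eq_zero_iff, norm_sub_sq_real, real_inner_comm,
      ← inner_kernelL2 hρ, hF, Lp.norm_compMeasurePreserving, Lp.norm_compMeasurePreserving,
      real_inner_self_eq_norm_sq]
    ring
  have h1 : ∀ᵐ p ∂(ρ ⊗ₘ g), F p.2 = F p.1 := by
    have a1 := Lp.coeFn_compMeasurePreserving F (measurePreserving_snd_compProd hρ)
    rw [h0] at a1
    filter_upwards [a1, Lp.coeFn_compMeasurePreserving F (measurePreserving_fst_compProd g ρ)]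
      with p b1 b2
    exact b1.symm.trans b2
  have h2 := Measure.ae_ae_of_ae_compProd h1
  have hFm : Measurable F := (Lp.stronglyMeasurable F).measurable
  -- Preimages under `F` are almost invariant, hence null or conull, so `F` is almost everywhere
  -- constant.
  refine exists_eventuallyEq_const_of_forall_separating MeasurableSet fun U hU => ?_
  refine ae_mem_or_ae_notMem_of_invariant hg hρ (B := F ⁻¹' U) (hFm hU) ?_ ?_
  · filter_upwards [h2] with x hx hxU
    rw [measure_eq_zero_iff_ae_notMem]
    filter_upwards [hx] with y hy
    simp only [mem_compl_iff, mem_preimage, hy, not_not]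
    exact hxU
  · filter_upwards [h2] with x hx hxU
    rw [measure_eq_zero_iff_ae_notMem]
    filter_upwards [hx] with y hy
    simp only [mem_preimage, hy]
    exact hxU

theorem integral_kernelOp_iterate (hρ : Kernel.Invariant g ρ) {f : I → ℝ} (hf : Measurable f)
    {C : ℝ} (hC : ∀ x, |f x| ≤ C) (k : ℕ) : ∫ x, (kernelOp g)^[k] f x ∂ρ = ∫ x, f x ∂ρ := by
  induction k with
  | zero => rfl
  | succ k ih =>
    rw [Function.iterate_succ_apply', ← integral_comp_measure g ρ
      (measurable_kernelOp_iterate g hf k) (abs_kernelOp_iterate_le g hC k), hρ.def, ih]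

theorem memLp_of_abs_le (ρ : Measure I) [IsFiniteMeasure ρ] {f : I → ℝ} (hf : Measurable f) {C : ℝ}
    (hC : ∀ x, |f x| ≤ C) : MemLp f 2 ρ :=
  MemLp.of_bound hf.aestronglyMeasurable C (ae_of_all _ hC)

theorem toLp_kernelAverage (hρ : Kernel.Invariant g ρ) {f : I → ℝ} (hf : Measurable f) {C : ℝ}
    (hC : ∀ x, |f x| ≤ C) (h1 : MemLp f 2 ρ) (n : ℕ) (h2 : MemLp (kernelAverage g f n) 2 ρ) :
    birkhoffAverage ℝ (kernelL2 hρ) id n (h1.toLp f) = h2.toLp (kernelAverage g f n) := by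
  have hm : ∀ k, MemLp ((kernelOp g)^[k] f) 2 ρ := fun k =>
    memLp_of_abs_le ρ (measurable_kernelOp_iterate g hf k) (abs_kernelOp_iterate_le g hC k)
  have hit : ∀ k, (kernelL2 hρ)^[k] (h1.toLp f) = (hm k).toLp _ := by
    intro k
    induction k with
    | zero => rfl
    | succ k ih =>
      rw [Function.iterate_succ_apply', ih]
      have h3 : MemLp (kernelOp g ((kernelOp g)^[k] f)) 2 ρ := by
        rw [← Function.iterate_succ_apply' (kernelOp g)]; exact hm (k + 1)
      rw [kernelL2_toLp hρ (measurable_kernelOp_iterate g hf k) (abs_kernelOp_iterate_le g hC k)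
        (hm k) h3]
      congr 1
      exact (Function.iterate_succ_apply' (kernelOp g) k f).symm
  have hms : ∀ n, MemLp (fun x => ∑ k ∈ Finset.range n, (kernelOp g)^[k] f x) 2 ρ := fun n =>
    memLp_finsetSum _ fun k _ => hm k
  have hsum : ∀ n, ∑ k ∈ Finset.range n, (hm k).toLp _ = (hms n).toLp _ := by
    intro n
    induction n with
    | zero =>
      simp only [Finset.range_zero, Finset.sum_empty]
      exact (MemLp.toLp_zero _).symm
    | succ n ih =>
      rw [Finset.sum_range_succ, ih, ← MemLp.toLp_add]
      congr 1
      ext x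
      simp [Finset.sum_range_succ]
  rw [birkhoffAverage, birkhoffSum]
  simp only [id, hit, hsum]
  rw [← MemLp.toLp_const_smul]
  rfl

/-- The mean ergodic theorem for a Harris recurrent chain with an invariant probability measure. -/
theorem tendstoInMeasure_kernelAverage (hg : IsHarrisRecurrent g) (hρ : Kernel.Invariant g ρ)
    {f : I → ℝ} (hf : Measurable f) {C : ℝ} (hC : ∀ x, |f x| ≤ C) :
    TendstoInMeasure ρ (kernelAverage g f) atTop (fun _ => ∫ x, f x ∂ρ) := by
  have h1 : MemLp f 2 ρ := memLp_of_abs_le ρ hf hC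
  have hm : ∀ n, MemLp (kernelAverage g f n) 2 ρ := fun n =>
    memLp_of_abs_le ρ (measurable_kernelAverage g hf n) (abs_kernelAverage_le g hC n)
  have h := (kernelL2 hρ).tendsto_birkhoffAverage_orthogonalProjection (norm_kernelL2_le hρ)
    (h1.toLp f)
  set F := ((kernelL2 hρ).eqLocus (1 : Lp ℝ 2 ρ →L[ℝ] Lp ℝ 2 ρ)).orthogonalProjectionOnto
    (h1.toLp f) with hFdef
  have h' : Tendsto (fun n => (hm n).toLp _) atTop (𝓝 (F : Lp ℝ 2 ρ)) := by
    refine h.congr fun n => ?_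
    exact toLp_kernelAverage hρ hf hC h1 n (hm n)
  obtain ⟨c, hc⟩ := ae_eq_const_of_kernelL2_eq_self hg hρ (F := (F : Lp ℝ 2 ρ)) F.2
  -- Pairing with the constant 1 identifies `c`: all averages with `n ≠ 0` have integral `∫ f` by
  -- invariance.
  have hone : MemLp (fun _ : I => (1 : ℝ)) 2 ρ := memLp_const 1
  have hin := h'.inner (𝕜 := ℝ) (tendsto_const_nhds (x := hone.toLp _))
  have e1 : ∀ n : ℕ, n ≠ 0 →
      inner ℝ ((hm n).toLp _) (hone.toLp (fun _ : I => (1 : ℝ))) = ∫ x, f x ∂ρ := by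
    intro n hn
    rw [L2.inner_def]
    have : ∫ x, inner ℝ ((hm n).toLp _ x) (hone.toLp (fun _ : I => (1 : ℝ)) x) ∂ρ =
        ∫ x, kernelAverage g f n x ∂ρ := by
      refine integral_congr_ae ?_
      filter_upwards [(hm n).coeFn_toLp, hone.coeFn_toLp] with x a1 a2
      rw [a1, a2]
      simp
    rw [this]
    simp only [kernelAverage]
    rw [integral_const_mul, integral_finsetSum]
    · simp_rw [integral_kernelOp_iterate hρ hf hC]
      simp only [Finset.sum_const, Finset.card_range, nsmul_eq_mul]
      have : (n : ℝ) ≠ 0 := by exact_mod_cast hn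
      field_simp
    · intro k _
      exact integrable_of_abs_le _ (measurable_kernelOp_iterate g hf k)
        (abs_kernelOp_iterate_le g hC k)
  have e2 : inner ℝ (F : Lp ℝ 2 ρ) (hone.toLp (fun _ : I => (1 : ℝ))) = c := by
    rw [L2.inner_def]
    have : ∫ x, inner ℝ ((F : Lp ℝ 2 ρ) x) (hone.toLp (fun _ : I => (1 : ℝ)) x) ∂ρ =
        ∫ _, c ∂ρ := by
      refine integral_congr_ae ?_
      filter_upwards [hc, hone.coeFn_toLp] with x a1 a2
      rw [a1, a2]
      simp
    rw [this]
    simp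
  have hcf : c = ∫ x, f x ∂ρ := by
    rw [e2] at hin
    refine tendsto_nhds_unique hin (tendsto_const_nhds.congr' ?_)
    filter_upwards [eventually_ne_atTop 0] with n hn using (e1 n hn).symm
  have hT := tendstoInMeasure_of_tendsto_Lp h'
  rw [← hcf]
  exact (hT.congr_left fun n => (hm n).coeFn_toLp).congr_right hc

/-- The ergodic theorem, from every starting point. -/
theorem tendsto_kernelAverage (hg : IsHarrisRecurrent g) (hρ : Kernel.Invariant g ρ)
    {f : I → ℝ} (hf : Measurable f) {C : ℝ} (hC : ∀ x, |f x| ≤ C) (x : I) :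
    Tendsto (fun n => kernelAverage g f n x) atTop (𝓝 (∫ y, f y ∂ρ)) := by
  -- Convergence in measure gives almost everywhere convergence only along a further subsequence,
  -- which is enough here.
  refine tendsto_of_subseq_tendsto fun ns hns => ?_
  have hT : TendstoInMeasure ρ (fun i => kernelAverage g f (ns i)) atTop
      (fun _ => ∫ y, f y ∂ρ) := (tendstoInMeasure_kernelAverage hg hρ hf hC).comp hns
  obtain ⟨ms, hms, hae⟩ := hT.exists_seq_tendsto_ae
  refine ⟨ms, ?_⟩
  set c := ∫ y, f y ∂ρ with hc
  obtain ⟨N, hAN, hN, hN0, hNg⟩ := exists_null_absorbing_compl hρ (ae_iff.1 hae)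
  have hC0 : 0 ≤ C := (abs_nonneg _).trans (hC x)
  have hcC : |c| ≤ C := by
    have := norm_integral_le_of_norm_le_const (μ := ρ) (f := f) (C := C) (ae_of_all _ hC)
    simpa using this
  set u : ℕ → I → ℝ := fun i => kernelAverage g f (ns (ms i)) with hu
  have hum : ∀ i, Measurable (u i) := fun i => measurable_kernelAverage g hf _
  have huC : ∀ i y, |u i y| ≤ C := fun i y => abs_kernelAverage_le g hC _ y
  have hconv : ∀ y ∉ N, Tendsto (fun i => u i y) atTop (𝓝 c) := by
    intro y hy
    by_contra h
    exact hy (hAN h)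
  rw [Metric.tendsto_atTop]
  intro ε hε
  -- The number `k` of preliminary steps is fixed first, to make the mass left in the bad set `N`
  -- small; the shift cost `2 * k * C / n` then vanishes as `n` grows.
  have hnull := (tendsto_chainLaw_null hg hρ hN hN0 hNg x).const_mul (2 * C)
  rw [mul_zero] at hnull
  obtain ⟨k, hk⟩ := (hnull.eventually (gt_mem_nhds (show (0 : ℝ) < ε / 3 by positivity))).exists
  have hdom : Tendsto (fun i => ∫ w, Nᶜ.indicator (fun y => u i y - c) (w k) ∂chainLaw g x)
      atTop (𝓝 0) := by
    have := tendsto_integral_of_dominated_convergence (μ := chainLaw g x) (fun _ => 2 * C)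
      (F := fun i w => Nᶜ.indicator (fun y => u i y - c) (w k)) (f := fun _ => 0)
      (fun i => ((((hum i).sub measurable_const).indicator hN.compl).comp
        (measurable_pi_apply k)).aestronglyMeasurable)
      (integrable_const _)
      (fun i => ae_of_all _ fun w => by
        by_cases h : w k ∈ N
        · simp [h, hC0]
        · simp only [indicator_of_mem (mem_compl h), Real.norm_eq_abs]
          have := abs_sub (u i (w k)) c
          linarith [huC i (w k)])
      (ae_of_all _ fun w => by
        by_cases h : w k ∈ N
        · simp [h]
        · simp only [indicator_of_mem (mem_compl h)]
          simpa using (hconv _ h).sub_const c)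
    simpa using this
  have hbound : ∀ i, |∫ w, u i (w k) ∂chainLaw g x - c| ≤
      |∫ w, Nᶜ.indicator (fun y => u i y - c) (w k) ∂chainLaw g x| +
        2 * C * (chainLaw g x).real {w | w k ∈ N} := by
    intro i
    have hmk : MeasurableSet {w : ℕ → I | w k ∈ N} := hN.preimage (measurable_pi_apply k)
    have i1 : Integrable (fun w : ℕ → I => Nᶜ.indicator (fun y => u i y - c) (w k))
        (chainLaw g x) := by
      refine integrable_of_abs_le _ ((((hum i).sub measurable_const).indicator hN.compl).comp
        (measurable_pi_apply k)) (C := 2 * C) fun w => ?_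
      by_cases h : w k ∈ N
      · simp [h, hC0]
      · simp only [indicator_of_mem (mem_compl h)]
        have := abs_sub (u i (w k)) c
        linarith [huC i (w k)]
    have i2 : Integrable (fun w : ℕ → I => N.indicator (fun y => u i y - c) (w k))
        (chainLaw g x) := by
      refine integrable_of_abs_le _ ((((hum i).sub measurable_const).indicator hN).comp
        (measurable_pi_apply k)) (C := 2 * C) fun w => ?_
      by_cases h : w k ∈ N
      · simp only [indicator_of_mem h]
        have := abs_sub (u i (w k)) c
        linarith [huC i (w k)]
      · simp [h, hC0]
    have i3 : Integrable (fun w : ℕ → I => u i (w k)) (chainLaw g x) :=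
      integrable_of_abs_le _ ((hum i).comp (measurable_pi_apply k)) fun w => huC i _
    have e1 : ∫ w, u i (w k) ∂chainLaw g x - c =
        ∫ w, Nᶜ.indicator (fun y => u i y - c) (w k) ∂chainLaw g x +
          ∫ w, N.indicator (fun y => u i y - c) (w k) ∂chainLaw g x := by
      rw [← integral_add i1 i2]
      have : ∀ w : ℕ → I, Nᶜ.indicator (fun y => u i y - c) (w k) +
          N.indicator (fun y => u i y - c) (w k) = u i (w k) - c := fun w =>
        congrFun (indicator_compl_add_self N (fun y => u i y - c)) (w k)
      simp_rw [this]
      rw [integral_sub i3 (integrable_const _)]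
      simp
    have e2 : |∫ w, N.indicator (fun y => u i y - c) (w k) ∂chainLaw g x| ≤
        2 * C * (chainLaw g x).real {w | w k ∈ N} := by
      have h3 : (fun w : ℕ → I => N.indicator (fun y => u i y - c) (w k)) =
          {w : ℕ → I | w k ∈ N}.indicator (fun w => u i (w k) - c) := rfl
      rw [h3, integral_indicator hmk]
      refine norm_setIntegral_le_of_norm_le_const
        (f := fun w : ℕ → I => u i (w k) - c) (measure_lt_top (chainLaw g x) _) fun w _ => ?_
      rw [Real.norm_eq_abs]
      have := abs_sub (u i (w k)) c
      linarith [huC i (w k)]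
    rw [e1]
    exact (abs_add_le _ _).trans (by gcongr)
  have hn : Tendsto (fun i => ((ns (ms i) : ℕ) : ℝ)⁻¹ * (2 * k * C)) atTop (𝓝 0) := by
    have := (tendsto_inv_atTop_zero.comp (tendsto_natCast_atTop_atTop (R := ℝ))).comp
      (hns.comp hms.tendsto_atTop)
    simpa using this.mul_const (2 * k * C)
  have ev1 := hn.eventually (gt_mem_nhds (show (0 : ℝ) < ε / 3 by positivity))
  have ev2 := (tendsto_zero_iff_abs_tendsto_zero _).1 hdom |>.eventually
    (gt_mem_nhds (show (0 : ℝ) < ε / 3 by positivity))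
  obtain ⟨i₀, hi₀⟩ := eventually_atTop.1 (ev1.and ev2)
  refine ⟨i₀, fun i hi => ?_⟩
  obtain ⟨a1, a2⟩ := hi₀ i hi
  have a3 := abs_kernelAverage_sub_integral_le g hf hC x (ns (ms i)) k
  have a4 := hbound i
  simp only [Function.comp_apply] at a2
  rw [Real.dist_eq]
  have a5 : |kernelAverage g f (ns (ms i)) x - c| ≤
      |(∫ w, u i (w k) ∂chainLaw g x) - kernelAverage g f (ns (ms i)) x| +
        |∫ w, u i (w k) ∂chainLaw g x - c| := by
    rw [abs_sub_comm (∫ w, u i (w k) ∂chainLaw g x)]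
    exact abs_sub_le _ _ _
  linarith

/-- Convergence of the averaged distributions of a Harris recurrent chain. -/
theorem tendsto_average_chainLaw (hg : IsHarrisRecurrent g) (hρ : Kernel.Invariant g ρ)
    {A : Set I} (hA : MeasurableSet A) (x : I) :
    Tendsto (fun n : ℕ => (n : ℝ)⁻¹ *
      ∑ k ∈ Finset.range n, (chainLaw g x).real {w | w k ∈ A}) atTop (𝓝 (ρ.real A)) := by
  have hf : Measurable (A.indicator (fun _ => (1 : ℝ))) := measurable_const.indicator hA
  have hC : ∀ y, |A.indicator (fun _ => (1 : ℝ)) y| ≤ 1 := fun y => by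
    by_cases h : y ∈ A <;> simp [h]
  have h := tendsto_kernelAverage hg hρ hf hC x
  rw [integral_indicator_const _ hA, smul_eq_mul, mul_one] at h
  refine h.congr fun n => ?_
  rw [kernelAverage]
  congr 1
  refine Finset.sum_congr rfl fun k _ => ?_
  have h1 := integral_chainLaw_iterate g hf hC x k 0
  rw [zero_add] at h1
  rw [← h1]
  have h2 : (fun w : ℕ → I => (kernelOp g)^[0] (A.indicator (fun _ => (1 : ℝ))) (w k)) =
      {w : ℕ → I | w k ∈ A}.indicator (fun _ => (1 : ℝ)) := rfl
  have h3 : MeasurableSet {w : ℕ → I | w k ∈ A} := hA.preimage (measurable_pi_apply k)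
  rw [h2, integral_indicator_const _ h3, smul_eq_mul, mul_one]

end MeanErgodic

/-! ### From Cesàro means to Abel means. -/

section Abel

theorem hasSum_add_one_mul_geometric {x : ℝ} (h0 : 0 ≤ x) (h1 : x < 1) :
    HasSum (fun n : ℕ => ((n : ℝ) + 1) * x ^ n) (1 / (1 - x) ^ 2) := by
  have hx : ‖x‖ < 1 := by rwa [Real.norm_eq_abs, abs_of_nonneg h0]
  have := (hasSum_coe_mul_geometric_of_norm_lt_one hx).add (hasSum_geometric_of_lt_one h0 h1)
  have hx1 : 1 - x ≠ 0 := by linarith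
  have e : 1 / (1 - x) ^ 2 = x / (1 - x) ^ 2 + (1 - x)⁻¹ := by
    field_simp
    ring
  rw [e]
  exact this.congr_fun fun n => by ring

/-- Convergence of the averages of a bounded sequence implies convergence of its Abel means. -/
theorem tendsto_abel_of_tendsto_average {p : ℕ → ℝ} {C r : ℝ} (hp : ∀ n, |p n| ≤ C)
    (h : Tendsto (fun n : ℕ => (n : ℝ)⁻¹ * ∑ k ∈ Finset.range n, p k) atTop (𝓝 r)) :
    Tendsto (fun e : ℝ => e * ∑' n, (1 - e) ^ n * p n) (𝓝[>] 0) (𝓝 r) := by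
  set q : ℕ → ℝ := fun n => p n - r with hq
  set Q : ℕ → ℝ := fun n => ∑ k ∈ Finset.range n, q k with hQ
  have hqC : ∀ n, |q n| ≤ C + |r| := fun n => (abs_sub _ _).trans (by gcongr; exact hp n)
  set D := C + |r| with hD
  have hD0 : 0 ≤ D := (abs_nonneg _).trans (hqC 0)
  have hQD : ∀ n : ℕ, |Q n| ≤ n * D := fun n => by
    refine (Finset.abs_sum_le_sum_abs _ _).trans ?_
    refine (Finset.sum_le_sum fun k _ => hqC k).trans ?_
    simp
  have hQlin : ∀ δ > 0, ∃ B ≥ 0, ∀ n : ℕ, |Q n| ≤ δ * n + B := by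
    intro δ hδ
    obtain ⟨K, hK⟩ := Metric.tendsto_atTop.1 h δ hδ
    refine ⟨K * D, by positivity, fun n => ?_⟩
    rcases lt_or_ge n K with hn | hn
    · have h1 : (n : ℝ) * D ≤ K * D := by
        have : (n : ℝ) ≤ K := by exact_mod_cast hn.le
        gcongr
      have h2 : 0 ≤ δ * n := by positivity
      linarith [hQD n]
    · rcases Nat.eq_zero_or_pos n with rfl | hn0
      · simp [hQ]; positivity
      · have hn0' : (0 : ℝ) < n := by exact_mod_cast hn0
        have h1 := (hK n hn).le
        have h2 : (n : ℝ)⁻¹ * ∑ k ∈ Finset.range n, p k - r = (n : ℝ)⁻¹ * Q n := by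
          simp only [hQ, hq, Finset.sum_sub_distrib, Finset.sum_const, Finset.card_range,
            nsmul_eq_mul]
          field_simp
        rw [Real.dist_eq, h2, abs_mul, abs_of_pos (by positivity)] at h1
        have h3 : |Q n| ≤ δ * n := by
          rw [inv_mul_le_iff₀ hn0'] at h1
          linarith
        have : (0 : ℝ) ≤ K * D := by positivity
        linarith
  have hkey : ∀ δ > 0, ∃ B ≥ 0, ∀ e : ℝ, 0 < e → e < 1 →
      |e * ∑' n, (1 - e) ^ n * p n - r| ≤ δ + B * e := by
    intro δ hδ
    obtain ⟨B, hB, hQB⟩ := hQlin δ hδ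
    refine ⟨B, hB, fun e he0 he1 => ?_⟩
    set x := 1 - e with hx
    have hx0 : 0 ≤ x := by linarith
    have hx1 : x < 1 := by linarith
    have hgeo := hasSum_geometric_of_lt_one hx0 hx1
    have hlin := hasSum_add_one_mul_geometric hx0 hx1
    have hsp : Summable fun n => x ^ n * p n := by
      refine Summable.of_norm_bounded (hgeo.summable.mul_left C) fun n => ?_
      rw [norm_mul, norm_pow, Real.norm_eq_abs, abs_of_nonneg hx0, mul_comm]
      gcongr
      exact hp n
    have hsQ1 : Summable fun n => x ^ n * Q (n + 1) := by
      refine Summable.of_norm_bounded (hlin.summable.mul_left D) fun n => ?_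
      rw [norm_mul, norm_pow, Real.norm_eq_abs, Real.norm_eq_abs, abs_of_nonneg hx0]
      have := hQD (n + 1)
      push_cast at this
      calc x ^ n * |Q (n + 1)| ≤ x ^ n * ((n + 1) * D) := by gcongr
        _ = D * ((n + 1) * x ^ n) := by ring
    have hsQ : Summable fun n => x ^ n * Q n := by
      rw [← summable_nat_add_iff 1]
      refine (hsQ1.mul_left x).congr fun n => ?_
      ring
    have e1 : ∑' n, x ^ n * Q n = x * ∑' n, x ^ n * Q (n + 1) := by
      rw [hsQ.tsum_eq_zero_add, ← tsum_mul_left]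
      simp only [hQ, Finset.range_zero, Finset.sum_empty, mul_zero, zero_add]
      exact tsum_congr fun n => by ring
    -- Summation by parts. Since `e ^ 2 * ∑ (n + 1) x ^ n = 1`, the bound `|Q n| ≤ δ n + B` becomes
    -- an error `δ + B e`.
    have e2 : ∑' n, x ^ n * q n = e * ∑' n, x ^ n * Q (n + 1) := by
      have : ∀ n, x ^ n * q n = x ^ n * Q (n + 1) - x ^ n * Q n := fun n => by
        simp only [hQ, Finset.sum_range_succ]; ring
      simp_rw [this]
      rw [hsQ1.tsum_sub hsQ, e1]
      simp only [hx]; ring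
    have e3 : e * ∑' n, x ^ n * p n - r = e * ∑' n, x ^ n * q n := by
      have : ∀ n, x ^ n * q n = x ^ n * p n - x ^ n * r := fun n => by simp only [hq]; ring
      simp_rw [this]
      rw [hsp.tsum_sub (hgeo.summable.mul_right r), tsum_mul_right, hgeo.tsum_eq]
      have : 1 - x = e := by simp only [hx]; ring
      rw [this]
      field_simp
    have e4 : |∑' n, x ^ n * Q (n + 1)| ≤ δ * (1 / (1 - x) ^ 2) + B * (1 - x)⁻¹ := by
      have hs := (hlin.mul_left δ).add (hgeo.mul_left B)
      refine tsum_of_norm_bounded (f := fun n => x ^ n * Q (n + 1)) hs fun n => ?_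
      rw [norm_mul, norm_pow, Real.norm_eq_abs, Real.norm_eq_abs, abs_of_nonneg hx0]
      have := hQB (n + 1)
      push_cast at this
      calc x ^ n * |Q (n + 1)| ≤ x ^ n * (δ * (n + 1) + B) := by gcongr
        _ = δ * ((n + 1) * x ^ n) + B * x ^ n := by ring
    have hxe : 1 - x = e := by simp only [hx]; ring
    rw [hxe] at e4
    rw [e3, e2, ← mul_assoc, abs_mul, abs_of_pos (by positivity : 0 < e * e)]
    calc e * e * |∑' n, x ^ n * Q (n + 1)| ≤ e * e * (δ * (1 / e ^ 2) + B * e⁻¹) := by gcongr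
      _ = δ + B * e := by field_simp
  rw [Metric.tendsto_nhds]
  intro ε hε
  obtain ⟨B, hB, hb⟩ := hkey (ε / 2) (by positivity)
  have hlim : Tendsto (fun e : ℝ => ε / 2 + B * e) (𝓝[>] 0) (𝓝 (ε / 2 + B * 0)) :=
    ((continuous_const.add (continuous_const.mul continuous_id)).tendsto 0).mono_left
      nhdsWithin_le_nhds
  have hev := hlim.eventually (gt_mem_nhds (show ε / 2 + B * 0 < ε by linarith))
  filter_upwards [hev, Ioo_mem_nhdsGT (zero_lt_one (α := ℝ))] with e h1 h2
  exact (hb e h2.1 h2.2).trans_lt h1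

end Abel

/-! ### Truncated means under a slowly varying tail. -/

section SlowVariation

theorem antitone_one_sub_cdf (ν : Measure ℝ) : Antitone fun t => 1 - cdf ν t :=
  fun _ _ h => sub_le_sub_left (monotone_cdf ν h) 1

theorem tendsto_one_sub_cdf_atTop (ν : Measure ℝ) :
    Tendsto (fun t => 1 - cdf ν t) atTop (𝓝 0) := by
  simpa using (tendsto_cdf_atTop ν).const_sub 1

/-- `4 * δ` is the fixed point of `x ↦ 3/4 * x + δ`. Iterating over dyadic scales first bounds `r`,
then contracts its excess over `4 * δ` geometrically below `δ`. -/
theorem eventually_le_of_halving_recursion {r : ℝ → ℝ} {C T δ : ℝ} (hT : 0 < T) (hδ : 0 < δ)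
    (hC : 0 ≤ C) (hbdd : ∀ t, 0 < t → t ≤ T → r t ≤ C)
    (hrec : ∀ t, T < t → r t ≤ 3 / 4 * r (t / 2) + δ) :
    ∀ᶠ t in atTop, r t ≤ 5 * δ := by
  have h1 : ∀ k : ℕ, ∀ t, 0 < t → t ≤ 2 ^ k * T → r t ≤ C + 4 * δ := by
    intro k
    induction k with
    | zero => intro t h0 ht; linarith [hbdd t h0 (by simpa using ht)]
    | succ k ih =>
      intro t h0 ht
      rcases le_or_gt t T with h | h
      · linarith [hbdd t h0 h]
      · have := ih (t / 2) (by linarith) (by rw [pow_succ] at ht; linarith)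
        linarith [hrec t h]
  have h2 : ∀ t, 0 < t → r t ≤ C + 4 * δ := by
    intro t h0
    obtain ⟨k, hk⟩ := pow_unbounded_of_one_lt (t / T) (one_lt_two (α := ℝ))
    exact h1 k t h0 ((div_lt_iff₀ hT).1 hk).le
  have h3 : ∀ k : ℕ, ∀ t, 2 ^ k * T < t → r t ≤ (3 / 4) ^ k * (C + 4 * δ) + 4 * δ := by
    intro k
    induction k with
    | zero =>
      intro t ht
      have := h2 t (by rw [pow_zero, one_mul] at ht; linarith)
      rw [pow_zero]
      linarith
    | succ k ih =>
      intro t ht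
      rw [pow_succ] at ht
      have hk : (1 : ℝ) ≤ 2 ^ k := one_le_pow₀ one_le_two
      have e1 := ih (t / 2) (by linarith)
      have e2 := hrec t (by nlinarith)
      rw [pow_succ]
      linarith
  have hlim : Tendsto (fun k : ℕ => (3 / 4 : ℝ) ^ k * (C + 4 * δ)) atTop (𝓝 0) := by
    simpa using (tendsto_pow_atTop_nhds_zero_of_lt_one (r := (3 / 4 : ℝ)) (by norm_num)
      (by norm_num)).mul_const (C + 4 * δ)
  obtain ⟨k, hk⟩ := (hlim.eventually (gt_mem_nhds hδ)).exists
  filter_upwards [eventually_gt_atTop (2 ^ k * T)] with t ht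
  linarith [h3 k t ht]

/-- The truncated mean `E[Y; Y ≤ t]` of a nonnegative random variable. -/
noncomputable def truncMean (ν : Measure ℝ) (t : ℝ) : ℝ := ∫ y in Icc 0 t, y ∂ν

variable {ν : Measure ℝ}

theorem truncMean_nonneg (t : ℝ) : 0 ≤ truncMean ν t :=
  setIntegral_nonneg measurableSet_Icc fun _ hy => hy.1

variable [IsProbabilityMeasure ν]

theorem integrableOn_id_Icc (t : ℝ) : IntegrableOn (fun y : ℝ => y) (Icc 0 t) ν :=
  continuous_id.continuousOn.integrableOn_compact isCompact_Icc

theorem truncMean_le {t : ℝ} (ht : 0 ≤ t) : truncMean ν t ≤ t := by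
  have h := setIntegral_mono_on (integrableOn_id_Icc (ν := ν) t)
    (integrableOn_const (C := t) (measure_ne_top _ _)) measurableSet_Icc fun y hy => hy.2
  rw [setIntegral_const, smul_eq_mul] at h
  exact h.trans (mul_le_of_le_one_left ht measureReal_le_one)

theorem truncMean_le_half {t : ℝ} (ht : 0 < t) :
    truncMean ν t ≤ truncMean ν (t / 2) + t * (cdf ν t - cdf ν (t / 2)) := by
  have hu : Icc 0 t = Icc 0 (t / 2) ∪ Ioc (t / 2) t := by
    rw [Icc_union_Ioc_eq_Icc] <;> linarith
  have hi : IntegrableOn (fun y : ℝ => y) (Ioc (t / 2) t) ν :=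
    (integrableOn_id_Icc t).mono_set (hu ▸ subset_union_right)
  have hd : Disjoint (Icc 0 (t / 2)) (Ioc (t / 2) t) :=
    Set.disjoint_left.2 fun y h1 h2 => absurd h1.2 (not_le.2 h2.1)
  have e1 : truncMean ν t = truncMean ν (t / 2) + ∫ y in Ioc (t / 2) t, y ∂ν := by
    rw [truncMean, hu, setIntegral_union hd measurableSet_Ioc (integrableOn_id_Icc _) hi]
    rfl
  have e2 : ∫ y in Ioc (t / 2) t, y ∂ν ≤ ν.real (Ioc (t / 2) t) * t := by
    have h := setIntegral_mono_on hi
      (integrableOn_const (C := t) (measure_ne_top _ _)) measurableSet_Ioc fun y hy => hy.2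
    rwa [setIntegral_const, smul_eq_mul] at h
  have e3 : ν.real (Ioc (t / 2) t) = cdf ν t - cdf ν (t / 2) := by
    rw [cdf_eq_real, cdf_eq_real, ← Iic_sdiff_Iic,
      measureReal_sdiff (Iic_subset_Iic.2 (by linarith)) measurableSet_Iic]
  rw [e1]
  rw [e3] at e2
  linarith

/-- If the tail is slowly varying, the truncated mean is negligible with respect to `t` times the
tail at `t`. -/
theorem tendsto_truncMean_div (hF : IsSlowlyVarying (fun t => 1 - cdf ν t)) :
    Tendsto (fun t => truncMean ν t / (t * (1 - cdf ν t))) atTop (𝓝 0) := by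
  obtain ⟨hpos, hsv⟩ := hF
  set r : ℝ → ℝ := fun t => truncMean ν t / (t * (1 - cdf ν t)) with hr
  have hr0 : ∀ t, 0 < t → 0 ≤ r t := fun t ht =>
    div_nonneg (truncMean_nonneg t) (mul_pos ht (hpos t ht)).le
  have key : ∀ δ > 0, δ ≤ 1 / 2 → ∀ᶠ t in atTop, r t ≤ 5 * δ := by
    intro δ hδ hδ2
    -- Beyond `T`, `L(t/2) < (1 + δ) L(t) ≤ 3/2 L(t)`. Splitting the truncated mean at `t/2` then
    -- gives factor `1/2 * 3/2 = 3/4` and remainder `L(t/2)/L(t) - 1 ≤ δ`.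
    have hev := (hsv (1 / 2) (by norm_num)).eventually
      (gt_mem_nhds (show (1 : ℝ) < 1 + δ by linarith))
    obtain ⟨T, hT⟩ := eventually_atTop.1 (hev.and (eventually_ge_atTop 1))
    have hT1 : 1 ≤ T := (hT T le_rfl).2
    have hT0 : 0 < T := by linarith
    refine eventually_le_of_halving_recursion (C := 1 / (1 - cdf ν T)) hT0 hδ
      (one_div_nonneg.2 (hpos T hT0).le) ?_ ?_
    · intro t h0 ht
      have hL := hpos t h0
      have hLT := hpos T hT0
      have hLL : 1 - cdf ν T ≤ 1 - cdf ν t := antitone_one_sub_cdf ν ht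
      calc r t ≤ t / (t * (1 - cdf ν t)) := by
            simp only [hr]; gcongr; exact truncMean_le h0.le
        _ = 1 / (1 - cdf ν t) := by field_simp
        _ ≤ 1 / (1 - cdf ν T) := by
            apply one_div_le_one_div_of_le hLT hLL
    · intro t ht
      have h0 : 0 < t := by linarith
      have hL := hpos t h0
      have hL2 := hpos (t / 2) (by linarith)
      simp only at hL hL2
      have h1 := (hT t ht.le).1
      rw [one_div_mul_eq_div, div_lt_iff₀ hL] at h1
      have h2 := truncMean_le_half (ν := ν) h0
      have h3 : r (t / 2) * (t / 2 * (1 - cdf ν (t / 2))) = truncMean ν (t / 2) :=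
        div_mul_cancel₀ _ (by positivity)
      have h4 := hr0 (t / 2) (by linarith)
      change truncMean ν t / (t * (1 - cdf ν t)) ≤ _
      rw [div_le_iff₀ (by positivity)]
      set Lt := 1 - cdf ν t
      set Lh := 1 - cdf ν (t / 2)
      have h5 : cdf ν t - cdf ν (t / 2) = Lh - Lt := by simp only [Lt, Lh]; ring
      rw [h5] at h2
      have h6 : r (t / 2) * (t / 2 * Lh) ≤ r (t / 2) * (t / 2 * (3 / 2 * Lt)) := by
        gcongr
        nlinarith
      have h7 : t * (Lh - Lt) ≤ t * (δ * Lt) := by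
        gcongr
        linarith
      calc truncMean ν t ≤ r (t / 2) * (t / 2 * (3 / 2 * Lt)) + t * (δ * Lt) := by linarith
        _ = (3 / 4 * r (t / 2) + δ) * (t * Lt) := by ring
  rw [Metric.tendsto_nhds]
  intro ε hε
  have hm : 0 < min (ε / 6) (1 / 2) := by positivity
  filter_upwards [key _ hm (min_le_right _ _), eventually_gt_atTop 0] with t ht h0
  rw [Real.dist_eq, sub_zero, abs_of_nonneg (hr0 t h0)]
  have := min_le_left (ε / 6) (1 / 2)
  change r t < ε
  linarith

end SlowVariation

/-! ### The single big jump for fixed parameters. -/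

section BigJump

variable {Ω : Type*}

/-- The event that the waiting times are nonnegative, the first `n` of them sum up to less than `t`
and the next one exceeds `t`. -/
def bigJumpEvent (X : ℕ → Ω → ℝ) (t : ℝ) (n : ℕ) : Set Ω :=
  {ω | (∀ j, 0 ≤ X j ω) ∧ ∑ j ∈ Finset.range n, X j ω < t ∧ t < X n ω}

/-- Nonnegativity makes partial sums monotone, so `n + 1` is the first index reaching `t`; the
current parameter is thus the one of index `n`. -/
theorem renewalCount_of_mem_bigJumpEvent {X : ℕ → Ω → ℝ} {t : ℝ} {n : ℕ} {ω : Ω}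
    (h : ω ∈ bigJumpEvent X t n) : renewalCount X t ω = n + 1 := by
  obtain ⟨h0, h1, h2⟩ := h
  have hmem : n + 1 ∈ {n : ℕ | t ≤ ∑ j ∈ Finset.range n, X j ω} := by
    change t ≤ _
    rw [Finset.sum_range_succ]
    linarith [Finset.sum_nonneg fun j (_ : j ∈ Finset.range n) => h0 j]
  refine le_antisymm (Nat.sInf_le hmem) ?_
  refine le_csInf ⟨_, hmem⟩ fun k hk => ?_
  by_contra! hlt
  have : ∑ j ∈ Finset.range k, X j ω ≤ ∑ j ∈ Finset.range n, X j ω :=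
    Finset.sum_le_sum_of_subset_of_nonneg (Finset.range_mono (by omega)) fun j _ _ => h0 j
  exact absurd (hk.trans this) (not_le.2 h1)

variable [MeasurableSpace Ω]

theorem measurableSet_bigJumpEvent {X : ℕ → Ω → ℝ} (hX : ∀ j, Measurable (X j)) (t : ℝ) (n : ℕ) :
    MeasurableSet (bigJumpEvent X t n) := by
  have h1 : MeasurableSet {ω | ∀ j, 0 ≤ X j ω} := by
    rw [ofPred_forall]
    exact MeasurableSet.iInter fun j => measurableSet_le measurable_const (hX j)
  have h2 : MeasurableSet {ω | ∑ j ∈ Finset.range n, X j ω < t} :=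
    measurableSet_lt (Finset.measurable_sum _ fun j _ => hX j) measurable_const
  exact h1.inter (h2.inter (measurableSet_lt measurable_const (hX n)))

/-- Markov's inequality for the sum restricted to all `X j ≤ t`: independence factors each summand
into one truncated mean and `n - 1` probabilities. Keeping `R ^ (n - 1)` makes the later sum over
`n` converge. -/
theorem measure_mul_le_of_forall_le {P : Measure Ω} {n : ℕ} {X : ℕ → Ω → ℝ}
    (hX : ∀ j, Measurable (X j)) (hindep : iIndepFun X P) {t : ℝ} {M R : ℝ≥0∞}
    (hM : ∀ j, ∫⁻ ω, (Iic t).indicator ENNReal.ofReal (X j ω) ∂P ≤ M)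
    (hR : ∀ j, P {ω | X j ω ≤ t} ≤ R) :
    ENNReal.ofReal t * P {ω | (∀ j < n, X j ω ≤ t) ∧ t ≤ ∑ j ∈ Finset.range n, X j ω} ≤
      n * (M * R ^ (n - 1)) := by
  let f : ℕ → ℕ → ℝ → ℝ≥0∞ := fun i j =>
    if j = i then (Iic t).indicator ENNReal.ofReal else (Iic t).indicator 1
  have hf : ∀ i j, Measurable (f i j) := by
    intro i j
    by_cases h : j = i
    · simpa [f, h] using ENNReal.measurable_ofReal.indicator measurableSet_Iic
    · simpa [f, h] using measurable_one.indicator measurableSet_Iic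
  have hsub : {ω | (∀ j < n, X j ω ≤ t) ∧ t ≤ ∑ j ∈ Finset.range n, X j ω} ⊆
      {ω | ENNReal.ofReal t ≤
        ∑ i ∈ Finset.range n, ∏ j ∈ Finset.range n, f i j (X j ω)} := by
    rintro ω ⟨h1, h2⟩
    have h3 : ∀ i ∈ Finset.range n, ∏ j ∈ Finset.range n, f i j (X j ω) =
        ENNReal.ofReal (X i ω) := by
      intro i hi
      rw [Finset.prod_eq_single i]
      · simp [f, h1 i (Finset.mem_range.1 hi)]
      · intro j hj hji
        simp [f, hji, h1 j (Finset.mem_range.1 hj)]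
      · exact fun h => absurd hi h
    change ENNReal.ofReal t ≤ _
    rw [Finset.sum_congr rfl h3]
    refine (ENNReal.ofReal_le_ofReal h2).trans ?_
    -- Signs are not controlled here, so `ENNReal.ofReal` is only subadditive.
    exact Finset.le_sum_of_subadditive _ ENNReal.ofReal_zero.le
      (fun _ _ => ENNReal.ofReal_add_le) _ _
  have hprod : ∀ i ∈ Finset.range n,
      ∫⁻ ω, ∏ j ∈ Finset.range n, f i j (X j ω) ∂P ≤ M * R ^ (n - 1) := by
    intro i hi
    rw [lintegral_prod_eq_prod_lintegral_of_indepFun _ (fun j ω => f i j (X j ω))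
      (hindep.comp _ (hf i)) fun j => (hf i j).comp (hX j),
      ← Finset.mul_prod_erase _ _ hi]
    refine mul_le_mul' ?_ ?_
    · simpa [f] using hM i
    · refine (Finset.prod_le_pow_card _ _ R fun j hj => ?_).trans_eq ?_
      · have hji : j ≠ i := Finset.ne_of_mem_erase hj
        have e : (fun ω => f i j (X j ω)) = {ω | X j ω ≤ t}.indicator 1 := by
          ext ω
          simp [f, hji, indicator_apply]
        rw [e, lintegral_indicator_one (measurableSet_le (hX j) measurable_const)]
        exact hR j
      · rw [Finset.card_erase_of_mem hi, Finset.card_range]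
  calc ENNReal.ofReal t * P {ω | (∀ j < n, X j ω ≤ t) ∧ t ≤ ∑ j ∈ Finset.range n, X j ω}
      ≤ ENNReal.ofReal t * P {ω | ENNReal.ofReal t ≤
          ∑ i ∈ Finset.range n, ∏ j ∈ Finset.range n, f i j (X j ω)} := by gcongr
    _ ≤ ∫⁻ ω, ∑ i ∈ Finset.range n, ∏ j ∈ Finset.range n, f i j (X j ω) ∂P :=
        mul_meas_ge_le_lintegral (Finset.measurable_sum _ fun i _ =>
          Finset.measurable_prod _ fun j _ => (hf i j).comp (hX j)) _
    _ = ∑ i ∈ Finset.range n, ∫⁻ ω, ∏ j ∈ Finset.range n, f i j (X j ω) ∂P :=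
        lintegral_finsetSum _ fun i _ =>
          Finset.measurable_prod _ fun j _ => (hf i j).comp (hX j)
    _ ≤ ∑ i ∈ Finset.range n, M * R ^ (n - 1) := Finset.sum_le_sum hprod
    _ = n * (M * R ^ (n - 1)) := by simp

variable {ν : Measure ℝ} [IsProbabilityMeasure ν] {l : ℕ → ℝ} {P : Measure Ω}
  [IsProbabilityMeasure P] {X : ℕ → Ω → ℝ}

namespace IsSTRP

theorem map_eq (hX : IsSTRP ν l P X) {j : ℕ} (hl : 0 < l j) :
    P.map (X j) = ν.map (fun y => y / l j) := by
  have : IsProbabilityMeasure (P.map (X j)) :=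
    Measure.isProbabilityMeasure_map (hX.measurable j).aemeasurable
  refine Measure.ext_of_Iic _ _ fun t => ?_
  rw [Measure.map_apply (hX.measurable j) measurableSet_Iic,
    Measure.map_apply (by fun_prop) measurableSet_Iic]
  refine (hX.distribution j t).trans ?_
  rw [ofReal_cdf]
  congr 1
  ext y
  simp [div_le_iff₀ hl, mul_comm]

theorem ae_nonneg (hX : IsSTRP ν l P X) (hν : ν (Iio 0) = 0) (hl : ∀ j, 0 < l j) :
    ∀ᵐ ω ∂P, ∀ j, 0 ≤ X j ω := by
  rw [ae_all_iff]
  intro j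
  have h : ∀ᵐ x ∂P.map (X j), 0 ≤ x := by
    rw [hX.map_eq (hl j), ae_map_iff (by fun_prop) measurableSet_Ici]
    have h1 : ∀ᵐ y ∂ν, y ∉ Iio (0 : ℝ) := measure_eq_zero_iff_ae_notMem.1 hν
    filter_upwards [h1] with y hy
    exact div_nonneg (not_lt.1 hy) (hl j).le
  exact ae_of_ae_map (hX.measurable j).aemeasurable h

/-- In law `X j` is `Y / l j`; for `Y ≥ 0`, `Y / l j ≤ t` forces `Y ≤ b * t`, and `Y / l j ≤ Y / a`.
-/
theorem lintegral_trunc_le (hX : IsSTRP ν l P X) {a b : ℝ} (ha : 0 < a)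
    (hal : ∀ j, a ≤ l j) (hlb : ∀ j, l j ≤ b) {t : ℝ} (ht : 0 < t) (j : ℕ) :
    ∫⁻ ω, (Iic t).indicator ENNReal.ofReal (X j ω) ∂P ≤
      ENNReal.ofReal (truncMean ν (b * t) / a) := by
  have hl : 0 < l j := ha.trans_le (hal j)
  have hm : Measurable ((Iic t).indicator ENNReal.ofReal) :=
    ENNReal.measurable_ofReal.indicator measurableSet_Iic
  rw [← lintegral_map hm (hX.measurable j), hX.map_eq hl, lintegral_map hm (by fun_prop),
    div_eq_inv_mul, ENNReal.ofReal_mul (by positivity), truncMean,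
    ofReal_integral_eq_lintegral_ofReal (integrableOn_id_Icc _)
      ((ae_restrict_mem measurableSet_Icc).mono fun y hy => hy.1),
    ← lintegral_indicator measurableSet_Icc,
    ← lintegral_const_mul _ (ENNReal.measurable_ofReal.indicator measurableSet_Icc)]
  refine lintegral_mono fun y => ?_
  by_cases hy : y / l j ∈ Iic t
  · rcases lt_or_ge y 0 with h0 | h0
    · rw [indicator_of_mem hy, ENNReal.ofReal_of_nonpos (div_nonpos_of_nonpos_of_nonneg h0.le hl.le)]
      exact zero_le
    · have hyb : y ∈ Icc 0 (b * t) := by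
        refine ⟨h0, ((div_le_iff₀ hl).1 hy).trans ?_⟩
        rw [mul_comm]
        gcongr
        exact hlb j
      rw [indicator_of_mem hy, indicator_of_mem hyb, ← ENNReal.ofReal_mul (by positivity),
        ← div_eq_inv_mul]
      exact ENNReal.ofReal_le_ofReal (div_le_div_of_nonneg_left h0 ha (hal j))
  · rw [indicator_of_notMem hy]
    exact zero_le

theorem le_measureReal_sum_lt (hX : IsSTRP ν l P X) {a b : ℝ} (ha : 0 < a)
    (hal : ∀ j, a ≤ l j) (hlb : ∀ j, l j ≤ b) {t : ℝ} (ht : 0 < t) (n : ℕ) :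
    cdf ν (a * t) ^ n - n * (truncMean ν (b * t) / a / t * cdf ν (b * t) ^ (n - 1)) ≤
      P.real {ω | ∑ j ∈ Finset.range n, X j ω < t} := by
  set U : Set Ω := {ω | ∀ j < n, X j ω ≤ t} with hU
  set V : Set Ω := {ω | (∀ j < n, X j ω ≤ t) ∧ t ≤ ∑ j ∈ Finset.range n, X j ω} with hV
  have h1 : cdf ν (a * t) ^ n ≤ P.real U := by
    have e : U = ⋂ j ∈ Finset.range n, X j ⁻¹' Iic t := by
      ext ω; simp [hU]
    have e2 : P U = ∏ j ∈ Finset.range n, P (X j ⁻¹' Iic t) := by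
      rw [e]
      exact hX.indep.measure_inter_preimage_eq_mul _ fun j _ => measurableSet_Iic
    have e3 : ∀ j, P (X j ⁻¹' Iic t) = ENNReal.ofReal (cdf ν (l j * t)) :=
      fun j => hX.distribution j t
    rw [measureReal_def, e2, ENNReal.toReal_prod]
    simp_rw [e3, ENNReal.toReal_ofReal (cdf_nonneg ν _)]
    calc cdf ν (a * t) ^ n = ∏ j ∈ Finset.range n, cdf ν (a * t) := by simp
      _ ≤ _ := Finset.prod_le_prod (fun j _ => cdf_nonneg ν _) fun j _ =>
        monotone_cdf ν (by gcongr; exact hal j)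
  have h2 : P.real V ≤ n * (truncMean ν (b * t) / a / t * cdf ν (b * t) ^ (n - 1)) := by
    have hR : ∀ j, P {ω | X j ω ≤ t} ≤ ENNReal.ofReal (cdf ν (b * t)) := fun j => by
      rw [hX.distribution j t]
      exact ENNReal.ofReal_le_ofReal (monotone_cdf ν (by gcongr; exact hlb j))
    have h := measure_mul_le_of_forall_le (n := n) hX.measurable hX.indep
      (hX.lintegral_trunc_le ha hal hlb ht) hR
    have hm0 : 0 ≤ truncMean ν (b * t) / a := div_nonneg (truncMean_nonneg _) ha.le
    rw [← ENNReal.ofReal_pow (cdf_nonneg ν _), ← ENNReal.ofReal_mul hm0,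
      ← ENNReal.ofReal_natCast, ← ENNReal.ofReal_mul (Nat.cast_nonneg n),
      ← ofReal_measureReal (measure_ne_top P _), ← ENNReal.ofReal_mul ht.le,
      ENNReal.ofReal_le_ofReal_iff (by
        have := cdf_nonneg ν (b * t)
        positivity)] at h
    rw [← le_div_iff₀' ht] at h
    refine h.trans_eq ?_
    ring
  have h3 : U ⊆ {ω | ∑ j ∈ Finset.range n, X j ω < t} ∪ V := by
    intro ω hω
    rcases lt_or_ge (∑ j ∈ Finset.range n, X j ω) t with h | h
    · exact Or.inl h
    · exact Or.inr ⟨hω, h⟩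
  have h4 := (measureReal_mono h3 (measure_ne_top P _)).trans (measureReal_union_le _ _)
  linarith

/-- The next waiting time is independent of the preceding sum. The bound is uniform over parameters
in `[a, b]`, so it can be integrated over the chain. -/
theorem le_measureReal_bigJumpEvent (hX : IsSTRP ν l P X) (hν : ν (Iio 0) = 0) {a b : ℝ}
    (ha : 0 < a) (hal : ∀ j, a ≤ l j) (hlb : ∀ j, l j ≤ b) {t : ℝ} (ht : 0 < t) (n : ℕ) :
    (1 - cdf ν (b * t)) * (cdf ν (a * t) ^ n -
      n * (truncMean ν (b * t) / a / t * cdf ν (b * t) ^ (n - 1))) ≤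
      P.real (bigJumpEvent X t n) := by
  have hl : ∀ j, 0 < l j := fun j => ha.trans_le (hal j)
  have hind : IndepFun (∑ j ∈ Finset.range n, X j) (X n) P :=
    hX.indep.indepFun_finsetSum_of_notMem hX.measurable (by simp)
  have e1 : P.real (bigJumpEvent X t n) =
      P.real {ω | ∑ j ∈ Finset.range n, X j ω < t} * P.real {ω | t < X n ω} := by
    have h := hind.measure_inter_preimage_eq_mul _ _ (measurableSet_Iio (a := t))
      (measurableSet_Ioi (a := t))
    have h' : P (bigJumpEvent X t n) =
        P ((∑ j ∈ Finset.range n, X j) ⁻¹' Iio t ∩ X n ⁻¹' Ioi t) := by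
      refine measure_congr ?_
      filter_upwards [hX.ae_nonneg hν hl] with ω hω
      simp only [eq_iff_iff]
      change ((∀ j, 0 ≤ X j ω) ∧ _ ∧ _) ↔ _ ∧ _
      simp [hω]
    rw [measureReal_def, h', h, ENNReal.toReal_mul]
    congr 3
    ext ω
    simp
  have e2 : 1 - cdf ν (b * t) ≤ P.real {ω | t < X n ω} := by
    have hc : {ω | t < X n ω} = {ω | X n ω ≤ t}ᶜ := by ext ω; simp
    rw [hc, probReal_compl_eq_one_sub (measurableSet_le (hX.measurable n) measurable_const),
      measureReal_def, hX.distribution, ENNReal.toReal_ofReal (cdf_nonneg ν _)]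
    have := monotone_cdf ν (show l n * t ≤ b * t by gcongr; exact hlb n)
    linarith
  have e3 := hX.le_measureReal_sum_lt ha hal hlb ht n
  have e4 : 0 ≤ 1 - cdf ν (b * t) := sub_nonneg.2 (cdf_le_one ν _)
  rw [e1, mul_comm (P.real _)]
  calc _ ≤ (1 - cdf ν (b * t)) * P.real {ω | ∑ j ∈ Finset.range n, X j ω < t} := by gcongr
    _ ≤ _ := by gcongr

end IsSTRP

end BigJump

/-! ### Integration over the random parameters, and the limit. -/

section Renewal

theorem hasSum_mul_geometric_pred {x : ℝ} (h0 : 0 ≤ x) (h1 : x < 1) :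
    HasSum (fun n : ℕ => (n : ℝ) * x ^ (n - 1)) (1 / (1 - x) ^ 2) := by
  rw [← hasSum_nat_add_iff' 1]
  simpa using hasSum_add_one_mul_geometric h0 h1

variable {Ω : Type*} [MeasurableSpace Ω] {P : Measure Ω} [IsProbabilityMeasure P] {a b : ℝ}
  {ν : Measure ℝ} [IsProbabilityMeasure ν] {g : Kernel (Icc a b) (Icc a b)} [IsMarkovKernel g]
  {l₀ : Icc a b} {Lam : ℕ → Ω → Icc a b} {X : ℕ → Ω → ℝ}

/-- The event that, for some `n`, the first `n` waiting times sum up to less than `t`, the next one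
exceeds `t`, and its parameter lies in `A`. -/
def bigJumpParamEvent {Ω I : Type*} (Lam : ℕ → Ω → I) (X : ℕ → Ω → ℝ) (t : ℝ) (A : Set I) : Set Ω :=
  ⋃ n, {ω | Lam n ω ∈ A} ∩ bigJumpEvent X t n

theorem bigJumpParamEvent_subset {Ω I : Type*} (Lam : ℕ → Ω → I) (X : ℕ → Ω → ℝ) (t : ℝ)
    (A : Set I) :
    bigJumpParamEvent Lam X t A ⊆ {ω | Lam (renewalCount X t ω - 1) ω ∈ A} := by
  refine iUnion_subset fun n ω hω => ?_
  change Lam (renewalCount X t ω - 1) ω ∈ A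
  rw [renewalCount_of_mem_bigJumpEvent hω.2]
  exact hω.1

theorem measurableSet_bigJumpParamEvent {Ω I : Type*} [MeasurableSpace Ω] [MeasurableSpace I]
    {Lam : ℕ → Ω → I} {X : ℕ → Ω → ℝ} (hLam : ∀ n, Measurable (Lam n))
    (hX : ∀ n, Measurable (X n)) {A : Set I} (hA : MeasurableSet A) (t : ℝ) :
    MeasurableSet (bigJumpParamEvent Lam X t A) :=
  MeasurableSet.iUnion fun n => (hLam n hA).inter (measurableSet_bigJumpEvent hX t n)

namespace IsSTMRP

theorem le_measureReal_param_inter (hX : IsSTMRP ν g l₀ P Lam X) (hν : ν (Iio 0) = 0) (ha : 0 < a)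
    {A : Set (Icc a b)} (hA : MeasurableSet A) {t : ℝ} (ht : 0 < t) (n : ℕ) :
    (1 - cdf ν (b * t)) * (cdf ν (a * t) ^ n -
      n * (truncMean ν (b * t) / a / t * cdf ν (b * t) ^ (n - 1))) *
        (chainLaw g l₀).real {w | w n ∈ A} ≤
      P.real ({ω | Lam n ω ∈ A} ∩ bigJumpEvent X t n) := by
  obtain ⟨κ, hκ, hS, hlaw⟩ := hX.law
  set β := (1 - cdf ν (b * t)) * (cdf ν (a * t) ^ n -
      n * (truncMean ν (b * t) / a / t * cdf ν (b * t) ^ (n - 1))) with hβ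
  set G : Set (ℕ → ℝ) := bigJumpEvent (fun j x => x j) t n with hG
  have hGm : MeasurableSet G := measurableSet_bigJumpEvent (fun j => measurable_pi_apply j) t n
  have hAm : MeasurableSet {w : ℕ → Icc a b | w n ∈ A} := hA.preimage (measurable_pi_apply n)
  have hpair : Measurable fun ω => ((fun n => Lam n ω), (fun n => X n ω)) :=
    (measurable_pi_lambda _ hX.measurable_param).prodMk (measurable_pi_lambda _ hX.measurable_wait)
  have hset : {ω | Lam n ω ∈ A} ∩ bigJumpEvent X t n =
      (fun ω => ((fun n => Lam n ω), (fun n => X n ω))) ⁻¹'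
        ({w : ℕ → Icc a b | w n ∈ A} ×ˢ G) := rfl
  have hκG : ∀ l, ENNReal.ofReal β ≤ κ l G := fun l => by
    rw [← ofReal_measureReal (measure_ne_top (κ l) G)]
    exact ENNReal.ofReal_le_ofReal ((hS l).le_measureReal_bigJumpEvent hν ha
      (fun j => (l j).2.1) (fun j => (l j).2.2) ht n)
  have h1 : ENNReal.ofReal β * chainLaw g l₀ {w | w n ∈ A} ≤
      P ({ω | Lam n ω ∈ A} ∩ bigJumpEvent X t n) := by
    rw [hset, ← Measure.map_apply hpair (hAm.prod hGm), hlaw, Measure.compProd_apply_prod hAm hGm,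
      ← setLIntegral_const]
    exact lintegral_mono fun l => hκG l
  -- `β` may be negative for large `n`; `ENNReal.ofReal` loses that, but the claim is then trivial.
  rcases le_or_gt β 0 with h0 | h0
  · exact (mul_nonpos_of_nonpos_of_nonneg h0 measureReal_nonneg).trans measureReal_nonneg
  · have h2 := ENNReal.toReal_mono (measure_ne_top P _) h1
    rwa [ENNReal.toReal_mul, ENNReal.toReal_ofReal h0.le] at h2

theorem sum_le_measureReal_bigJumpParamEvent (hX : IsSTMRP ν g l₀ P Lam X) (hν : ν (Iio 0) = 0)
    (ha : 0 < a) {A : Set (Icc a b)} (hA : MeasurableSet A) {t : ℝ} (ht : 0 < t) (K : ℕ) :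
    ∑ n ∈ Finset.range K, (1 - cdf ν (b * t)) * (cdf ν (a * t) ^ n -
      n * (truncMean ν (b * t) / a / t * cdf ν (b * t) ^ (n - 1))) *
        (chainLaw g l₀).real {w | w n ∈ A} ≤
      P.real (bigJumpParamEvent Lam X t A) := by
  have hdisj : PairwiseDisjoint (↑(Finset.range K))
      fun n => {ω | Lam n ω ∈ A} ∩ bigJumpEvent X t n := by
    intro m _ n _ hmn
    refine Set.disjoint_left.2 fun ω h1 h2 => hmn ?_
    have e1 := renewalCount_of_mem_bigJumpEvent h1.2
    have e2 := renewalCount_of_mem_bigJumpEvent h2.2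
    omega
  refine (Finset.sum_le_sum fun n _ => hX.le_measureReal_param_inter hν ha hA ht n).trans ?_
  rw [← measureReal_biUnion_finset hdisj fun n _ => (hX.measurable_param n hA).inter
    (measurableSet_bigJumpEvent hX.measurable_wait t n)]
  exact measureReal_mono (iUnion₂_subset fun n _ => subset_iUnion
    (fun n => {ω | Lam n ω ∈ A} ∩ bigJumpEvent X t n) n)

/-- Summing over `n` turns `F(at)^n` into an Abel sum, and `∑ n F(bt)^(n-1) = (1 - F(bt))^(-2)`
turns the errors into the ratio controlled by `tendsto_truncMean_div`. -/
theorem le_measureReal_bigJumpParamEvent (hX : IsSTMRP ν g l₀ P Lam X) (hν : ν (Iio 0) = 0)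
    (hF : IsSlowlyVarying (fun t => 1 - cdf ν t)) (ha : 0 < a) (hab : a < b)
    {A : Set (Icc a b)} (hA : MeasurableSet A) {t : ℝ} (ht : 0 < t) :
    (1 - cdf ν (b * t)) / (1 - cdf ν (a * t)) * ((1 - cdf ν (a * t)) *
        ∑' n, (1 - (1 - cdf ν (a * t))) ^ n * (chainLaw g l₀).real {w | w n ∈ A}) -
      b / a * (truncMean ν (b * t) / (b * t * (1 - cdf ν (b * t)))) ≤
      P.real (bigJumpParamEvent Lam X t A) := by
  have hb : 0 < b := ha.trans hab
  set p : ℕ → ℝ := fun n => (chainLaw g l₀).real {w | w n ∈ A} with hp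
  set Fa := cdf ν (a * t) with hFa
  set Fb := cdf ν (b * t) with hFb
  set m := truncMean ν (b * t) with hm
  have hm0 : 0 ≤ m := truncMean_nonneg _
  have hFa0 : 0 ≤ Fa := cdf_nonneg ν _
  have hFb0 : 0 ≤ Fb := cdf_nonneg ν _
  have hFa1 : 0 < 1 - Fa := hF.1 (a * t) (by positivity)
  have hFb1 : 0 < 1 - Fb := hF.1 (b * t) (by positivity)
  have hs1 : Summable fun n => Fa ^ n * p n := by
    refine Summable.of_nonneg_of_le (fun n => mul_nonneg (by positivity) measureReal_nonneg)
      (fun n => mul_le_of_le_one_right (by positivity) measureReal_le_one)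
      (summable_geometric_of_lt_one hFa0 (by linarith))
  have hs2 := hasSum_mul_geometric_pred hFb0 (by linarith)
  have hs := (hs1.hasSum.mul_left (1 - Fb)).sub (hs2.mul_left ((1 - Fb) * (m / a / t)))
  have hle : (1 - Fb) * ∑' n, Fa ^ n * p n - (1 - Fb) * (m / a / t) * (1 / (1 - Fb) ^ 2) ≤
      P.real (bigJumpParamEvent Lam X t A) := by
    refine le_of_tendsto hs.tendsto_sum_nat (Eventually.of_forall fun K => ?_)
    refine le_trans (Finset.sum_le_sum fun n _ => ?_)
      (hX.sum_le_measureReal_bigJumpParamEvent hν ha hA ht K)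
    have h1 : p n ≤ 1 := measureReal_le_one
    -- The error terms enter negatively, so dropping their factor `p n ≤ 1` only lowers the bound.
    have h2 : 0 ≤ (1 - Fb) * (m / a / t) * (n * Fb ^ (n - 1)) := by positivity
    have h3 := mul_le_mul_of_nonneg_left h1 h2
    calc (1 - Fb) * (Fa ^ n * p n) - (1 - Fb) * (m / a / t) * (n * Fb ^ (n - 1))
        ≤ (1 - Fb) * (Fa ^ n * p n) - (1 - Fb) * (m / a / t) * (n * Fb ^ (n - 1)) * p n := by
          linarith
      _ = _ := by ring
  refine le_trans (le_of_eq ?_) hle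
  rw [sub_sub_cancel]
  congr 1
  · field_simp
    rfl
  · field_simp

/-- The lower bound for the limiting distribution of the parameter of the current renewal. -/
theorem exists_tendsto_le_measureReal (hX : IsSTMRP ν g l₀ P Lam X) (hν : ν (Iio 0) = 0)
    (hF : IsSlowlyVarying (fun t => 1 - cdf ν t)) (ha : 0 < a) (hab : a < b)
    (hg : IsHarrisRecurrent g) {ρ : Measure (Icc a b)} [IsProbabilityMeasure ρ]
    (hρ : Kernel.Invariant g ρ) {A : Set (Icc a b)} (hA : MeasurableSet A) :
    ∃ ψ : ℝ → ℝ, Tendsto ψ atTop (𝓝 (ρ.real A)) ∧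
      ∀ᶠ t in atTop, ψ t ≤ P.real (bigJumpParamEvent Lam X t A) := by
  have hb : 0 < b := ha.trans hab
  have hat : Tendsto (fun t : ℝ => a * t) atTop atTop := tendsto_id.const_mul_atTop ha
  have hbt : Tendsto (fun t : ℝ => b * t) atTop atTop := tendsto_id.const_mul_atTop hb
  have h1 : Tendsto (fun t => (1 - cdf ν (b * t)) / (1 - cdf ν (a * t))) atTop (𝓝 1) := by
    refine ((hF.2 (b / a) (by positivity)).comp hat).congr fun t => ?_
    have : b / a * (a * t) = b * t := by field_simp
    simp only [Function.comp_apply, this]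
  have h2 : Tendsto (fun t => 1 - cdf ν (a * t)) atTop (𝓝[>] 0) := by
    refine tendsto_nhdsWithin_iff.2 ⟨(tendsto_one_sub_cdf_atTop ν).comp hat, ?_⟩
    filter_upwards [eventually_gt_atTop 0] with t ht
    exact hF.1 (a * t) (by positivity)
  have h3 := (tendsto_abel_of_tendsto_average (C := 1)
    (p := fun n => (chainLaw g l₀).real {w | w n ∈ A})
    (fun n => by rw [abs_of_nonneg measureReal_nonneg]; exact measureReal_le_one)
    (tendsto_average_chainLaw hg hρ hA l₀)).comp h2
  have h4 := ((tendsto_truncMean_div hF).comp hbt).const_mul (b / a)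
  have h5 := (h1.mul h3).sub h4
  rw [one_mul, mul_zero, sub_zero] at h5
  refine ⟨_, h5, ?_⟩
  filter_upwards [eventually_gt_atTop 0] with t ht
  exact hX.le_measureReal_bigJumpParamEvent hν hF ha hab hA ht

end IsSTMRP

end Renewal

theorem theorem5 {Ω : Type*} [MeasurableSpace Ω] (P : Measure Ω) [IsProbabilityMeasure P]
    (a b : ℝ) (ha : 0 < a) (hab : a < b)
    (ν : Measure ℝ) [IsProbabilityMeasure ν] (hν : ν (Iio 0) = 0)
    (hF : IsSlowlyVarying (fun t => 1 - cdf ν t))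
    (g : Kernel (Icc a b) (Icc a b)) [IsMarkovKernel g] (hg : IsHarrisRecurrent g)
    (ρs : Measure (Icc a b)) [IsProbabilityMeasure ρs] (hρ : Kernel.Invariant g ρs)
    (l₀ : Icc a b) (Lam : ℕ → Ω → Icc a b) (X : ℕ → Ω → ℝ)
    (hX : IsSTMRP ν g l₀ P Lam X)
    (A : Set (Icc a b)) (hA : MeasurableSet A) :
    Tendsto (fun t : ℝ => currentParamProb P Lam X t A) atTop (𝓝 (ρs A)) := by
  obtain ⟨ψ, hψ, hψle⟩ := hX.exists_tendsto_le_measureReal hν hF ha hab hg hρ hA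
  obtain ⟨φ, hφ, hφle⟩ := hX.exists_tendsto_le_measureReal hν hF ha hab hg hρ hA.compl
  have hlim : Tendsto (fun t => 1 - φ t) atTop (𝓝 (ρs.real A)) := by
    have := hφ.const_sub 1
    rwa [probReal_compl_eq_one_sub hA, sub_sub_cancel] at this
  have hreal : Tendsto (fun t => (currentParamProb P Lam X t A).toReal) atTop
      (𝓝 (ρs A).toReal) := by
    refine tendsto_of_tendsto_of_tendsto_of_le_of_le' hψ hlim ?_ ?_
    · filter_upwards [hψle] with t ht
      exact ht.trans (measureReal_mono (bigJumpParamEvent_subset Lam X t A))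
    · filter_upwards [hφle] with t ht
      -- A big jump with parameter in `Aᶜ` excludes a current parameter in `A`, so the lower bound
      -- for `Aᶜ` is an upper bound for `A`.
      have h1 : {ω | Lam (renewalCount X t ω - 1) ω ∈ A} ⊆
          (bigJumpParamEvent Lam X t Aᶜ)ᶜ := fun ω hω hω' =>
        bigJumpParamEvent_subset Lam X t Aᶜ hω' hω
      have h2 := measureReal_mono (μ := P) h1
      rw [probReal_compl_eq_one_sub (measurableSet_bigJumpParamEvent hX.measurable_param
        hX.measurable_wait hA.compl t)] at h2
      change P.real {ω | Lam (renewalCount X t ω - 1) ω ∈ A} ≤ _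
      linarith
  exact (ENNReal.tendsto_toReal_iff (fun t => measure_ne_top P _) (measure_ne_top ρs A)).1 hreal
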